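/- Let $\hat A$ be the $\mathbb{C}$-algebra of formal sums $\sum_{\nu\ge 0}P_\nu(a)\,b^\nu$ with $P_\nu\in\mathbb{C}[[a]]$, whose product is determined by $ab-ba=b^2$ and by the $b$-adic continuity of the left and right multiplications by elements of $\mathbb{C}[[a]]$. All modules are left $\hat A$-modules. A *simple pole (a,b)-module* is a module $E$ that is free and finitely generated over $\mathbb{C}[[b]]$ and satisfies $aE\subset bE$; a *regular (a,b)-module* is a module contained in a simple pole one. Let $E^\sharp$ be the smallest simple pole (a,b)-module containing a regular $E$; the Bernstein polynomial of $E$ is the minimal polynomial of $-b^{-1}a$ acting on $E^\sharp/bE^\sharp$. A *fresco* is a regular (a,b)-module that is generated by one element over $\hat A$ and whose Bernstein polynomial has only negative rational roots. For a rational $\lambda\in\,]0,1]$ a fresco is *$[\lambda]$-primitive* if $-z\in\lambda+\mathbb{Z}$ for each root $z$ of its Bernstein polynomial. For $N\ge 0$ let $\Xi_\lambda^{(N)}$ be the free $\mathbb{C}[[b]]$-module with basis $e_0,\dots,e_N$, on which $a$ acts $b$-adically continuously with $ae_0=\lambda b e_0$, $ae_j=\lambda b e_j+b e_{j-1}$ $(1\le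 j\le N)$ and $ab-ba=b^2$. A $[\lambda]$-primitive fresco $E$ is *semi-simple* if every $\hat A$-linear map $E\to\Xi_\lambda^{(N)}$, for every $N$, has rank at most $1$ over $\mathbb{C}[[b]]$. Put $E_\mu=\hat A/\hat A(a-\mu b)$. The *fundamental invariants* of a $[\lambda]$-primitive fresco $E$ of rank $k$ are the numbers $\lambda_1,\dots,\lambda_k$ for which there is a sequence of submodules $0=F_0\subset F_1\subset\cdots\subset F_k=E$ such that all $E/F_j$ are free over $\mathbb{C}[[b]]$, $F_j/F_{j-1}\simeq E_{\lambda_j}$ for $1\le j\le k$, and $\lambda_1+1\le\lambda_2+2\le\cdots\le\lambda_k+k$. **Proposition.** Let $\lambda_1>2$ be a rational number and $p_1\ge 2$, $p_2\ge 1$ integers; put $\lambda_2=\lambda_1+p_1-1$ and $\lambda_3=\lambda_2+p_2-1$. For $\gamma\in\mathbb{C}$ let $$E(\gamma)=\hat A\big/\hat A\,(a-\lambda_1 b)(1+\gamma b)^{-1}(a-\lambda_2 b)(a-\lambda_3 b).$$ 1. For each rational $\lambda\in\,]0,1]$, every semi-simple $[\lambda]$-primitive fresco of rank $3$ over $\mathbb{C}[[b]]$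 with fundamental invariants $\lambda_1,\lambda_2,\lambda_3$ is isomorphic, as an $\hat A$-module, to $E(\gamma)$ for some $\gamma\in\mathbb{C}$. 2. If $p_2\ge 2$, then $E(\gamma)$ and $E(\gamma')$ are not isomorphic for $\gamma\ne\gamma'$. 3. If $p_2=1$, then $E(\gamma)$ is isomorphic to $E(0)$ for every $\gamma\in\mathbb{C}$. -/

import Mathlib

noncomputable section

namespace Fresco

open Finset

/-- The underlying set of the algebra `Â`: the sequence `x` stands for the formal sum
`∑ ν, P_ν(a) b^ν` with `P_ν = x ν ∈ ℂ⟦a⟧`. -/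
def AHat : Type := ℕ → PowerSeries ℂ

namespace AHat

instance : AddCommGroup AHat := inferInstanceAs (AddCommGroup (ℕ → PowerSeries ℂ))

/-- The product determined by `b^j T(a) = ∑ m, (-1)^m (j+m-1 choose m) T^{(m)}(a) b^{j+m}`, which is
the consequence of `b T(a) = T(a) b - b T'(a) b`, that is of `a b - b a = b²` and of continuity;
`Nat.multichoose j m` is `(j+m-1 choose m)`. In the sum `n = j + m + l`, and the term is the
contribution of `P_j(a) b^j` and `Q_l(a) b^l` to the coefficient of `b^n`. -/
instance : Mul AHat :=
  ⟨fun x y n => ∑ p ∈ antidiagonal n, ∑ q ∈ antidiagonal p.1,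
    ((-1 : ℂ) ^ q.2 * (Nat.multichoose q.1 q.2 : ℂ)) •
      (x q.1 * (⇑(PowerSeries.derivative ℂ))^[q.2] (y p.2))⟩

theorem mul_apply (x y : AHat) (n : ℕ) :
    (x * y) n = ∑ p ∈ antidiagonal n, ∑ q ∈ antidiagonal p.1,
      ((-1 : ℂ) ^ q.2 * (Nat.multichoose q.1 q.2 : ℂ)) •
        (x q.1 * (⇑(PowerSeries.derivative ℂ))^[q.2] (y p.2)) := rfl

theorem coeff_iter_deriv (m r : ℕ) (f : PowerSeries ℂ) :
    PowerSeries.coeff r ((⇑(PowerSeries.derivative ℂ))^[m] f) =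
      ((r + 1).ascFactorial m : ℂ) * PowerSeries.coeff (r + m) f := by
  induction m generalizing r with
  | zero => simp
  | succ m ih =>
    rw [Function.iterate_succ_apply', PowerSeries.coeff_derivative, ih,
      show r + 1 + m = r + (m + 1) by ring]
    have h : (r + 1).ascFactorial (m + 1) = (r + 1) * (r + 1 + 1).ascFactorial m :=
      (Nat.succ_ascFactorial (r + 1) m) ▸ (Nat.ascFactorial_succ)
    rw [h]
    push_cast
    ring

/-- `asc i s = (X + s)(X + s + 1) ⋯ (X + s + i - 1)`. -/
def asc : ℕ → ℕ → Polynomial ℂ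
  | 0, _ => 1
  | i + 1, s => (Polynomial.X + (s : Polynomial ℂ)) * asc i (s + 1)

theorem asc_add (r i s : ℕ) : asc (r + i) s = asc r s * asc i (s + r) := by
  induction r generalizing s with
  | zero => simp [asc]
  | succ r ih =>
    rw [show r + 1 + i = (r + i) + 1 by ring, asc, asc, ih, mul_assoc,
      show s + 1 + r = s + (r + 1) by ring]

theorem asc_key (j k s : ℕ) :
    ∑ p ∈ antidiagonal k, ((-1 : ℂ) ^ p.1 * (Nat.multichoose j p.1 : ℂ) *
      ((p.2 + 1).ascFactorial p.1 : ℂ)) • asc p.2 (s + j + p.1) = asc k s := by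
  induction j generalizing k s with
  | zero =>
    cases k with
    | zero => simp
    | succ k => simp [Nat.sum_antidiagonal_succ]
  | succ j ihj =>
    induction k generalizing s with
    | zero => simp [asc]
    | succ k ihk =>
      have h1 := ihj (k + 1) (s + 1)
      have h2 := ihk (s + 1)
      rw [Nat.sum_antidiagonal_succ] at h1 ⊢
      have e : asc (k + 1) s = asc (k + 1) (s + 1) - ((k : ℂ) + 1) • asc k (s + 1) := by
        rw [asc_add k 1 (s + 1)]
        simp only [asc, Polynomial.smul_eq_C_mul]
        simp only [map_add, map_natCast, map_one]
        push_cast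
        ring
      rw [e, ← h1, ← h2, smul_sum, add_sub_assoc, ← sum_sub_distrib]
      congr 1
      · simp [show s + (j + 1) = s + 1 + j by ring]
      · refine sum_congr rfl fun p hp => ?_
        rw [show s + (j + 1) + (p.1 + 1) = s + 1 + (j + 1) + p.1 by ring,
          show s + 1 + j + (p.1 + 1) = s + 1 + (j + 1) + p.1 by ring, smul_smul, ← sub_smul]
        congr 1
        rw [Nat.multichoose_succ_succ, Nat.ascFactorial_succ]
        have : k = p.1 + p.2 := (mem_antidiagonal.1 hp).symm
        subst this
        push_cast
        ring

/-- The homogeneous part of degree `e` of `x`, as it acts in degree `f`. -/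
def symb (x : AHat) (e f : ℕ) : Polynomial ℂ :=
  ∑ p ∈ antidiagonal e, PowerSeries.coeff p.1 (x p.2) • asc p.1 (f + p.2)

theorem symb_mul (x y : AHat) (d f : ℕ) :
    symb (x * y) d f = ∑ p ∈ antidiagonal d, symb x p.1 (f + p.2) * symb y p.2 f := by
  have L : symb (x * y) d f =
      ∑ u ∈ antidiagonal d, ∑ p ∈ antidiagonal u.2, ∑ q ∈ antidiagonal p.1,
        ∑ v ∈ antidiagonal u.1,
        (((-1 : ℂ) ^ q.2 * (Nat.multichoose q.1 q.2 : ℂ)) *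
          (PowerSeries.coeff v.1 (x q.1) * (((v.2 + 1).ascFactorial q.2 : ℂ) *
            PowerSeries.coeff (v.2 + q.2) (y p.2)))) • asc u.1 (f + u.2) := by
    unfold symb
    refine sum_congr rfl fun u _ => ?_
    rw [mul_apply]
    simp only [map_sum, PowerSeries.coeff_smul, PowerSeries.coeff_mul, coeff_iter_deriv,
      sum_smul, mul_sum, smul_eq_mul]
  have R : ∑ p ∈ antidiagonal d, symb x p.1 (f + p.2) * symb y p.2 f =
      ∑ p ∈ antidiagonal d, ∑ v ∈ antidiagonal p.1, ∑ w ∈ antidiagonal p.2,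
        ∑ z ∈ antidiagonal w.1,
        (((-1 : ℂ) ^ z.1 * (Nat.multichoose v.2 z.1 : ℂ)) *
          (PowerSeries.coeff v.1 (x v.2) * (((z.2 + 1).ascFactorial z.1 : ℂ) *
            PowerSeries.coeff (z.2 + z.1) (y w.2)))) • 
              asc (v.1 + z.2) (f + (v.2 + z.1 + w.2)) := by
    refine sum_congr rfl fun p hp => ?_
    unfold symb
    rw [sum_mul]
    refine sum_congr rfl fun v hv => ?_
    rw [mul_sum]
    refine sum_congr rfl fun w hw => ?_
    rw [← asc_key v.2 w.1 (f + w.2)]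
    rw [smul_sum, mul_sum]
    refine sum_congr rfl fun z hz => ?_
    rw [smul_smul, smul_mul_smul_comm, mul_comm (asc _ _)]
    have hz' := mem_antidiagonal.1 hz
    have hw' := mem_antidiagonal.1 hw
    rw [show f + p.2 + v.2 = (f + w.2 + v.2 + z.1) + z.2 by omega, ← asc_add,
      show f + (v.2 + z.1 + w.2) = f + w.2 + v.2 + z.1 by omega, show z.2 + v.1 = v.1 + z.2 by omega,
      show z.2 + z.1 = w.1 by omega]
    congr 1
    ring
  rw [L, R]
  simp only [sum_sigma']
  refine sum_nbij'
    (fun t => ⟨(t.2.2.2.1 + t.2.2.1.1, t.2.2.1.2 + t.2.2.2.2 + t.2.1.2),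
      (t.2.2.2.1, t.2.2.1.1), (t.2.2.1.2 + t.2.2.2.2, t.2.1.2), (t.2.2.1.2, t.2.2.2.2)⟩)
    (fun t => ⟨(t.2.1.1 + t.2.2.2.2, t.2.1.2 + t.2.2.2.1 + t.2.2.1.2),
      (t.2.1.2 + t.2.2.2.1, t.2.2.1.2), (t.2.1.2, t.2.2.2.1), (t.2.1.1, t.2.2.2.2)⟩)
    ?_ ?_ ?_ ?_ ?_
  · rintro ⟨⟨u1, u2⟩, ⟨p1, p2⟩, ⟨q1, q2⟩, ⟨v1, v2⟩⟩ h
    simp only [mem_sigma, HasAntidiagonal.mem_antidiagonal] at h ⊢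
    refine ⟨?_, ?_, ?_, ?_⟩ <;> first | trivial | omega
  · rintro ⟨⟨u1, u2⟩, ⟨p1, p2⟩, ⟨q1, q2⟩, ⟨v1, v2⟩⟩ h
    simp only [mem_sigma, HasAntidiagonal.mem_antidiagonal] at h ⊢
    refine ⟨?_, ?_, ?_, ?_⟩ <;> first | trivial | omega
  · rintro ⟨⟨u1, u2⟩, ⟨p1, p2⟩, ⟨q1, q2⟩, ⟨v1, v2⟩⟩ h
    simp only [mem_sigma, HasAntidiagonal.mem_antidiagonal] at h
    obtain ⟨h1, h2, h3, h4⟩ := h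
    subst h4 h3 h2
    rfl
  · rintro ⟨⟨u1, u2⟩, ⟨p1, p2⟩, ⟨q1, q2⟩, ⟨v1, v2⟩⟩ h
    simp only [mem_sigma, HasAntidiagonal.mem_antidiagonal] at h
    obtain ⟨h1, h2, h3, h4⟩ := h
    subst h4 h3 h2
    rfl
  · rintro ⟨⟨u1, u2⟩, ⟨p1, p2⟩, ⟨q1, q2⟩, ⟨v1, v2⟩⟩ h
    simp only [mem_sigma, HasAntidiagonal.mem_antidiagonal] at h
    obtain ⟨h1, h2, h3, h4⟩ := h
    subst h4 h3 h2
    rfl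

theorem natDegree_asc (i s : ℕ) : (asc i s).degree = i := by
  induction i generalizing s with
  | zero => simp [asc]
  | succ i ih =>
    rw [asc, Polynomial.degree_mul, ih]
    rw [show (Polynomial.X + (s : Polynomial ℂ)) = Polynomial.X + Polynomial.C (s : ℂ) by simp,
      Polynomial.degree_X_add_C]
    push_cast
    ring

theorem symb_add (x y : AHat) (e f : ℕ) : symb (x + y) e f = symb x e f + symb y e f := by
  unfold symb
  rw [← sum_add_distrib]
  refine sum_congr rfl fun p _ => ?_
  rw [← add_smul, ← map_add]
  rfl

theorem symb_zero (e f : ℕ) : symb 0 e f = 0 := by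
  have h := symb_add 0 0 e f
  simpa using h

theorem ext_symb {x y : AHat} (h : ∀ e, symb x e 0 = symb y e 0) : x = y := by
  have key : ∀ z : AHat, (∀ e, symb z e 0 = 0) → z = 0 := by
    intro z hz
    funext j
    change z j = 0
    ext i
    let q : Polynomial.Sequence ℂ := ⟨fun k => asc k (i + j - k), fun k => natDegree_asc _ _⟩
    have hl := q.linearIndependent
    have h0 := hz (i + j)
    unfold symb at h0
    rw [Nat.sum_antidiagonal_eq_sum_range_succ_mk] at h0
    simp only [zero_add] at h0
    have := linearIndependent_iff'.1 hl (range (i + j).succ)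
      (fun k => PowerSeries.coeff k (z (i + j - k))) h0 i (by simp)
    simpa using this
  have hn : ∀ e, symb (-y) e 0 = - symb y e 0 := by
    intro e
    have h1 := symb_add (-y) y e 0
    rw [neg_add_cancel, symb_zero] at h1
    exact eq_neg_of_add_eq_zero_left h1.symm
  have := key (x + -y) (fun e => by rw [symb_add, hn, h, add_neg_cancel])
  rwa [← sub_eq_add_neg, sub_eq_zero] at this

instance : One AHat := ⟨fun n => if n = 0 then 1 else 0⟩

theorem symb_one (e f : ℕ) : symb 1 e f = if e = 0 then 1 else 0 := by
  have h1 : ∀ n, (1 : AHat) n = if n = 0 then 1 else 0 := fun _ => rfl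
  unfold symb
  split_ifs with h
  · subst h
    simp [h1, asc]
  · refine sum_eq_zero fun p hp => ?_
    have hp' := HasAntidiagonal.mem_antidiagonal.1 hp
    rw [h1]
    split_ifs with h2
    · rw [PowerSeries.coeff_one, if_neg (by omega), zero_smul]
    · simp

instance : Ring AHat :=
  { (inferInstance : AddCommGroup AHat), (inferInstance : Mul AHat),
    (inferInstance : One AHat) with
    left_distrib := fun x y z => ext_symb fun e => by
      simp only [symb_add, symb_mul, mul_add, sum_add_distrib]
    right_distrib := fun x y z => ext_symb fun e => by
      simp only [symb_add, symb_mul, add_mul, sum_add_distrib]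
    zero_mul := fun x => ext_symb fun e => by simp [symb_mul, symb_zero]
    mul_zero := fun x => ext_symb fun e => by simp [symb_mul, symb_zero]
    one_mul := fun x => ext_symb fun e => by
      rw [symb_mul, sum_eq_single (0, e)]
      · simp [symb_one]
      · rintro ⟨p, q⟩ hp hne
        have hp' := HasAntidiagonal.mem_antidiagonal.1 hp
        rw [symb_one, if_neg, zero_mul]
        rintro rfl
        exact hne (by simpa using hp')
      · simp
    mul_one := fun x => ext_symb fun e => by
      rw [symb_mul, sum_eq_single (e, 0)]
      · simp [symb_one]
      · rintro ⟨p, q⟩ hp hne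
        have hp' := HasAntidiagonal.mem_antidiagonal.1 hp
        rw [symb_one, if_neg, mul_zero]
        rintro rfl
        exact hne (by simpa using hp')
      · simp
    mul_assoc := fun x y z => ext_symb fun e => by
      simp only [symb_mul, sum_mul, mul_sum]
      rw [sum_sigma', sum_sigma']
      refine sum_nbij' (fun t => ⟨(t.2.1, t.2.2 + t.1.2), (t.2.2, t.1.2)⟩)
        (fun t => ⟨(t.1.1 + t.2.1, t.2.2), (t.1.1, t.2.1)⟩) ?_ ?_ ?_ ?_ ?_
      · rintro ⟨⟨u1, u2⟩, ⟨p1, p2⟩⟩ h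
        simp only [mem_sigma, HasAntidiagonal.mem_antidiagonal] at h ⊢
        refine ⟨?_, ?_⟩ <;> first | trivial | omega
      · rintro ⟨⟨u1, u2⟩, ⟨p1, p2⟩⟩ h
        simp only [mem_sigma, HasAntidiagonal.mem_antidiagonal] at h ⊢
        refine ⟨?_, ?_⟩ <;> first | trivial | omega
      · rintro ⟨⟨u1, u2⟩, ⟨p1, p2⟩⟩ h
        simp only [mem_sigma, HasAntidiagonal.mem_antidiagonal] at h
        obtain ⟨h1, h2⟩ := h
        subst h2
        rfl
      · rintro ⟨⟨u1, u2⟩, ⟨p1, p2⟩⟩ h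
        simp only [mem_sigma, HasAntidiagonal.mem_antidiagonal] at h
        obtain ⟨h1, h2⟩ := h
        subst h2
        rfl
      · rintro ⟨⟨u1, u2⟩, ⟨p1, p2⟩⟩ h
        simp only
        rw [mul_assoc, show 0 + u2 + p2 = 0 + (p2 + u2) by omega] }

/-- The variable `a`. -/
def a : AHat := fun n => if n = 0 then PowerSeries.X else 0

/-- `S(b) = ∑ n, s_n b^n`, with the constants `s_n` as elements of `ℂ⟦a⟧`. -/
def bFun (S : PowerSeries ℂ) : AHat := fun n => PowerSeries.C (PowerSeries.coeff n S)

theorem symb_bFun (S : PowerSeries ℂ) (e f : ℕ) :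
    symb (bFun S) e f = Polynomial.C (PowerSeries.coeff e S) := by
  unfold symb bFun
  rw [sum_eq_single (0, e)]
  · simp [asc, Polynomial.smul_eq_C_mul]
  · rintro ⟨p, q⟩ hp hne
    have hp' := HasAntidiagonal.mem_antidiagonal.1 hp
    rw [PowerSeries.coeff_C, if_neg, zero_smul]
    rintro rfl
    exact hne (by simpa using hp')
  · simp

/-- The embedding `S ↦ S(b)` of `ℂ⟦b⟧` in `Â`. -/
def bSeries : PowerSeries ℂ →+* AHat where
  toFun := bFun
  map_one' := ext_symb fun e => by
    rw [symb_bFun, symb_one, PowerSeries.coeff_one]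
    split_ifs <;> simp
  map_zero' := ext_symb fun e => by
    rw [symb_bFun, symb_zero, map_zero, map_zero]
  map_add' S T := ext_symb fun e => by
    rw [symb_bFun, symb_add, symb_bFun, symb_bFun, map_add, map_add]
  map_mul' S T := ext_symb fun e => by
    rw [symb_bFun, symb_mul, PowerSeries.coeff_mul, map_sum]
    simp only [symb_bFun, map_mul]

/-- The variable `b`. -/
def b : AHat := bSeries PowerSeries.X

theorem symb_a (e f : ℕ) :
    symb a e f = if e = 1 then Polynomial.X + (f : Polynomial ℂ) else 0 := by
  have h1 : ∀ n, a n = if n = 0 then PowerSeries.X else 0 := fun _ => rfl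
  unfold symb
  rw [sum_eq_single (e, 0)]
  · rw [h1, if_pos rfl, PowerSeries.coeff_X]
    split_ifs with h
    · subst h
      simp [asc]
    · simp
  · rintro ⟨p, q⟩ hp hne
    have hp' := HasAntidiagonal.mem_antidiagonal.1 hp
    rw [h1, if_neg, map_zero, zero_smul]
    rintro rfl
    exact hne (by simpa using hp')
  · simp

theorem symb_b (e f : ℕ) : symb b e f = if e = 1 then 1 else 0 := by
  change symb (bFun PowerSeries.X) e f = _
  rw [symb_bFun, PowerSeries.coeff_X]
  split_ifs <;> simp

theorem a_mul_b_sub_b_mul_a : a * b - b * a = b ^ 2 := by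
  rw [sub_eq_iff_eq_add]
  refine ext_symb fun e => ?_
  rw [symb_add, pow_two, symb_mul, symb_mul, symb_mul, ← sum_add_distrib]
  refine sum_congr rfl fun p _ => ?_
  simp only [symb_a, symb_b]
  split_ifs <;> simp_all [add_comm]

end AHat


/-! ### Left `Â`-modules -/

section Modules

open AHat

universe u

/-- The `ℂ⟦b⟧`-module underlying a left `Â`-module. -/
abbrev bModule (E : Type u) [AddCommGroup E] [Module AHat E] : Module (PowerSeries ℂ) E :=
  Module.compHom E bSeries

/-- The complex vector space underlying a left `Â`-module. -/
abbrev cModule (E : Type u) [AddCommGroup E] [Module AHat E] : Module ℂ E :=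
  Module.compHom E (bSeries.comp (PowerSeries.C (R := ℂ)))

/-- `E` is free and finitely generated over `ℂ⟦b⟧`. -/
def IsFreeFinite (E : Type u) [AddCommGroup E] [Module AHat E] : Prop :=
  letI := bModule E
  Module.Free (PowerSeries ℂ) E ∧ Module.Finite (PowerSeries ℂ) E

/-- The rank of `E` over `ℂ⟦b⟧`. -/
def abRank (E : Type u) [AddCommGroup E] [Module AHat E] : ℕ :=
  letI := bModule E
  Module.finrank (PowerSeries ℂ) E

/-- Simple pole (a,b)-modules: free and finitely generated over `ℂ⟦b⟧`, with `a E ⊆ b E`. -/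
def IsSimplePole (E : Type u) [AddCommGroup E] [Module AHat E] : Prop :=
  IsFreeFinite E ∧ ∀ x : E, ∃ y : E, a • x = b • y

/-- Regular (a,b)-modules: those contained in a simple pole (a,b)-module. -/
def IsRegular (E : Type u) [AddCommGroup E] [Module AHat E] : Prop :=
  ∃ (S : Type u) (_ : AddCommGroup S) (_ : Module AHat S) (i : E →ₗ[AHat] S),
    IsSimplePole S ∧ Function.Injective i

/-- `i : E → S` identifies `S` with `E^♯`, the smallest simple pole (a,b)-module containing `E`:
the only submodule `T` of `S` that contains `E` and satisfies `a T ⊆ b T` is `S`. -/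
def IsSharp {E S : Type u} [AddCommGroup E] [Module AHat E] [AddCommGroup S] [Module AHat S]
    (i : E →ₗ[AHat] S) : Prop :=
  IsSimplePole S ∧ Function.Injective i ∧
    ∀ T : Submodule AHat S, LinearMap.range i ≤ T →
      (∀ x ∈ T, ∃ y ∈ T, a • x = b • y) → T = ⊤

/-- The subspace `b S` of `S`. -/
def bSub (S : Type u) [AddCommGroup S] [Module AHat S] : @Submodule ℂ S _ _ (cModule S) :=
  letI := cModule S
  { carrier := {x | ∃ y : S, x = b • y}
    add_mem' := by
      rintro _ _ ⟨y, rfl⟩ ⟨z, rfl⟩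
      exact ⟨y + z, (smul_add _ _ _).symm⟩
    zero_mem' := ⟨0, (smul_zero _).symm⟩
    smul_mem' := by
      rintro c _ ⟨y, rfl⟩
      refine ⟨bSeries (PowerSeries.C c) • y, ?_⟩
      change bSeries (PowerSeries.C c) • b • y = _
      rw [smul_smul, smul_smul, b, ← map_mul, ← map_mul, mul_comm] }

/-- `B` is the Bernstein polynomial of `E`: the minimal polynomial of the endomorphism `T` of
`E^♯ / b E^♯` induced by `-b⁻¹ a`. -/
def IsBernsteinPolynomial (E : Type u) [AddCommGroup E] [Module AHat E] (B : Polynomial ℂ) :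
    Prop :=
  ∃ (S : Type u) (_ : AddCommGroup S) (_ : Module AHat S) (i : E →ₗ[AHat] S), IsSharp i ∧
    letI := cModule S
    ∃ T : Module.End ℂ (S ⧸ bSub S),
      (∀ x y : S, a • x = b • y → T ((bSub S).mkQ x) = -(bSub S).mkQ y) ∧ B = minpoly ℂ T

/-- Geometric (a,b)-modules: regular, and the roots of the Bernstein polynomial are negative
rational numbers. -/
def IsGeometric (E : Type u) [AddCommGroup E] [Module AHat E] : Prop :=
  IsRegular E ∧ ∃ B, IsBernsteinPolynomial E B ∧
    ∀ z : ℂ, B.IsRoot z → ∃ q : ℚ, q < 0 ∧ z = (q : ℂ)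

/-- Frescos: geometric (a,b)-modules generated by one element over `Â`. -/
def IsFresco (E : Type u) [AddCommGroup E] [Module AHat E] : Prop :=
  IsGeometric E ∧ ∃ e : E, Submodule.span AHat {e} = ⊤

/-- `E` is `[lam]`-primitive: for every root `z` of its Bernstein polynomial, `-z` lies in the class
`[lam]` of `lam` modulo `ℤ`. -/
def IsPrimitive (lam : ℚ) (E : Type u) [AddCommGroup E] [Module AHat E] : Prop :=
  ∃ B, IsBernsteinPolynomial E B ∧
    ∀ z : ℂ, B.IsRoot z → ∃ m : ℤ, -z = (lam : ℂ) + (m : ℂ)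

/-- The element `a - lam b` of `Â`. -/
def lin (lam : ℂ) : AHat := a - bSeries (PowerSeries.C lam) * b

/-- The rank one module `E_lam = Â / Â (a - lam b)`. -/
abbrev ERankOne (lam : ℂ) : Type := AHat ⧸ Submodule.span AHat {lin lam}

/-- `F 0 ⊆ ⋯ ⊆ F k` is a principal Jordan-Hölder sequence of `E` with
`F (j + 1) / F j ≃ E_{l j}`: all `F j` are normal (`E / F j` is free over `ℂ⟦b⟧`) and `l j + j` is
nondecreasing. -/
def IsPrincipalJH {E : Type u} [AddCommGroup E] [Module AHat E] {k : ℕ}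
    (F : Fin (k + 1) → Submodule AHat E) (l : Fin k → ℚ) : Prop :=
  F 0 = ⊥ ∧ F (Fin.last k) = ⊤ ∧ (∀ j, IsFreeFinite (E ⧸ F j)) ∧
    (∀ j : Fin k, F j.castSucc ≤ F j.succ ∧
      Nonempty ((F j.succ ⧸ (F j.castSucc).submoduleOf (F j.succ)) ≃ₗ[AHat]
        ERankOne ((l j : ℚ) : ℂ))) ∧
    Monotone fun j : Fin k => l j + ((j : ℕ) : ℚ)

/-- The sequence `l` is the sequence of fundamental invariants `λ_1, …, λ_k` of `E`. -/
def HasFundamentalInvariants (E : Type u) [AddCommGroup E] [Module AHat E] {k : ℕ}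
    (l : Fin k → ℚ) : Prop :=
  ∃ F : Fin (k + 1) → Submodule AHat E, IsPrincipalJH F l

end Modules

/-! ### The modules of asymptotic expansions -/

/-- The free `ℂ⟦b⟧`-module `Ξ_lam^{(N)}` with basis `e_0, …, e_N`: the family `v` stands for
`∑ j, v_j(b) e_j`. -/
def Xi (_lam : ℂ) (N : ℕ) : Type := Fin (N + 1) → PowerSeries ℂ

namespace Xi

variable {lam : ℂ} {N : ℕ}

instance : AddCommGroup (Xi lam N) := inferInstanceAs (AddCommGroup (Fin (N + 1) → PowerSeries ℂ))

/-- The action of `b`. -/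
def opB (v : Xi lam N) : Xi lam N := fun j => PowerSeries.X * v j

/-- The action of `a`: `a S(b) = S(b) a + b² S'(b)`, with `a e_0 = lam b e_0` and
`a e_j = lam b e_j + b e_{j-1}` for `1 ≤ j ≤ N`. -/
def opA (v : Xi lam N) : Xi lam N := fun j =>
  PowerSeries.C lam * PowerSeries.X * v j + PowerSeries.X ^ 2 * PowerSeries.derivative ℂ (v j) +
    if h : (j : ℕ) + 1 < N + 1 then PowerSeries.X * v ⟨(j : ℕ) + 1, h⟩ else 0

/-- `∑ c_{ij} a^i b^j` acts on `v` by `∑ c_{ij} a^i (b^j v)`; only the terms with `i + j ≤ n`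
contribute to the coefficients of `b^n`. -/
instance : SMul AHat (Xi lam N) :=
  ⟨fun x v k => PowerSeries.mk fun n => ∑ p ∈ antidiagonal n, ∑ q ∈ antidiagonal p.1,
    PowerSeries.coeff q.1 (x q.2) * PowerSeries.coeff n ((opA^[q.1] (opB^[q.2] v)) k)⟩

theorem smul_apply (x : AHat) (v : Xi lam N) (k : Fin (N + 1)) :
    (x • v) k = PowerSeries.mk fun n => ∑ p ∈ antidiagonal n, ∑ q ∈ antidiagonal p.1,
      PowerSeries.coeff q.1 (x q.2) * PowerSeries.coeff n ((opA^[q.1] (opB^[q.2] v)) k) := rfl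

/-- The coefficients of `b^n`. -/
def cf (n : ℕ) (v : Xi lam N) : Fin (N + 1) → ℂ := fun j => PowerSeries.coeff n (v j)

theorem ext_cf {v w : Xi lam N} (h : ∀ n, cf n v = cf n w) : v = w := by
  funext j
  ext n
  exact congrFun (h n) j

/-- The matrix `lam + nilpotent`. -/
def opD (lam : ℂ) (N : ℕ) : Module.End ℂ (Fin (N + 1) → ℂ) where
  toFun w := fun j => lam * w j + if h : (j : ℕ) + 1 < N + 1 then w ⟨(j : ℕ) + 1, h⟩ else 0
  map_add' v w := by
    funext j
    simp only [Pi.add_apply]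
    split_ifs <;> ring
  map_smul' c w := by
    funext j
    simp only [Pi.smul_apply, smul_eq_mul, RingHom.id_apply]
    split_ifs <;> ring

theorem cf_opA (n : ℕ) (v : Xi lam N) :
    cf (n + 1) (opA v) = opD lam N (cf n v) + (n : ℂ) • cf n v := by
  funext j
  have h2 : PowerSeries.coeff (n + 1) (PowerSeries.X ^ 2 * PowerSeries.derivative ℂ (v j)) =
      (n : ℂ) * PowerSeries.coeff n (v j) := by
    rw [pow_two, mul_assoc, PowerSeries.coeff_succ_X_mul]
    cases n with
    | zero => simp
    | succ n =>
      rw [PowerSeries.coeff_succ_X_mul, PowerSeries.coeff_derivative]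
      push_cast
      ring
  simp only [cf, opA, opD, LinearMap.coe_mk, AddHom.coe_mk, Pi.add_apply, Pi.smul_apply,
    smul_eq_mul, map_add, h2]
  rw [mul_assoc, PowerSeries.coeff_C_mul, PowerSeries.coeff_succ_X_mul]
  split_ifs
  · rw [PowerSeries.coeff_succ_X_mul]
    ring
  · simp

theorem cf_opA_iter (i f : ℕ) (v : Xi lam N) :
    cf (f + i) (opA^[i] v) = Polynomial.aeval (opD lam N) (AHat.asc i f) (cf f v) := by
  induction i with
  | zero => simp [AHat.asc]
  | succ i ih =>
    rw [Function.iterate_succ_apply', ← add_assoc, cf_opA, ih, AHat.asc_add i 1 f, mul_comm]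
    simp [AHat.asc]
    funext j
    simp [add_mul]

theorem cf_opB_iter (j f : ℕ) (v : Xi lam N) : cf (f + j) (opB^[j] v) = cf f v := by
  induction j with
  | zero => rfl
  | succ j ih =>
    rw [Function.iterate_succ_apply', ← ih]
    funext k
    exact PowerSeries.coeff_succ_X_mul _ _

theorem cf_smul (x : AHat) (n : ℕ) (v : Xi lam N) :
    cf n (x • v) = ∑ p ∈ antidiagonal n,
      Polynomial.aeval (opD lam N) (AHat.symb x p.1 p.2) (cf p.2 v) := by
  funext k
  rw [cf, smul_apply, PowerSeries.coeff_mk, Finset.sum_apply]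
  refine sum_congr rfl fun p hp => ?_
  rw [AHat.symb, map_sum, LinearMap.sum_apply, Finset.sum_apply]
  refine sum_congr rfl fun q hq => ?_
  have hp' := HasAntidiagonal.mem_antidiagonal.1 hp
  have hq' := HasAntidiagonal.mem_antidiagonal.1 hq
  rw [map_smul, LinearMap.smul_apply, Pi.smul_apply, smul_eq_mul, ← cf_opB_iter q.2 p.2 v,
    ← cf_opA_iter, show p.2 + q.2 + q.1 = n by omega]
  rfl

theorem cf_add (n : ℕ) (v w : Xi lam N) : cf n (v + w) = cf n v + cf n w := by
  funext j
  exact map_add (PowerSeries.coeff n) (v j) (w j)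

theorem cf_zero (n : ℕ) : cf n (0 : Xi lam N) = 0 := by
  funext j
  exact map_zero (PowerSeries.coeff n)

instance : Module AHat (Xi lam N) where
  one_smul v := ext_cf fun n => by
    rw [cf_smul, sum_eq_single (0, n)]
    · simp [AHat.symb_one]
    · rintro ⟨p, q⟩ hp hne
      have hp' := HasAntidiagonal.mem_antidiagonal.1 hp
      rw [AHat.symb_one, if_neg, map_zero, LinearMap.zero_apply]
      rintro rfl
      exact hne (by simpa using hp')
    · simp
  mul_smul x y v := ext_cf fun n => by
    simp only [cf_smul, AHat.symb_mul, map_sum, LinearMap.sum_apply, map_mul, Module.End.mul_apply]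
    rw [sum_sigma', sum_sigma']
    refine sum_nbij' (fun t => ⟨(t.2.1, t.2.2 + t.1.2), (t.2.2, t.1.2)⟩)
      (fun t => ⟨(t.1.1 + t.2.1, t.2.2), (t.1.1, t.2.1)⟩) ?_ ?_ ?_ ?_ ?_
    · rintro ⟨⟨u1, u2⟩, ⟨p1, p2⟩⟩ h
      simp only [mem_sigma, HasAntidiagonal.mem_antidiagonal] at h ⊢
      refine ⟨?_, ?_⟩ <;> first | trivial | omega
    · rintro ⟨⟨u1, u2⟩, ⟨p1, p2⟩⟩ h
      simp only [mem_sigma, HasAntidiagonal.mem_antidiagonal] at h ⊢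
      refine ⟨?_, ?_⟩ <;> first | trivial | omega
    · rintro ⟨⟨u1, u2⟩, ⟨p1, p2⟩⟩ h
      simp only [mem_sigma, HasAntidiagonal.mem_antidiagonal] at h
      obtain ⟨h1, h2⟩ := h
      subst h2
      rfl
    · rintro ⟨⟨u1, u2⟩, ⟨p1, p2⟩⟩ h
      simp only [mem_sigma, HasAntidiagonal.mem_antidiagonal] at h
      obtain ⟨h1, h2⟩ := h
      subst h2
      rfl
    · rintro ⟨⟨u1, u2⟩, ⟨p1, p2⟩⟩ h
      simp only
      rw [add_comm u2 p2]
  smul_zero x := ext_cf fun n => by simp [cf_smul, cf_zero]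
  smul_add x v w := ext_cf fun n => by simp [cf_smul, cf_add, sum_add_distrib]
  add_smul x y v := ext_cf fun n => by simp [cf_smul, cf_add, AHat.symb_add, sum_add_distrib]
  zero_smul v := ext_cf fun n => by simp [cf_smul, cf_zero, AHat.symb_zero]

theorem a_smul (v : Xi lam N) : AHat.a • v = opA v := ext_cf fun n => by
  rw [cf_smul]
  cases n with
  | zero =>
    funext j
    simp only [cf, opA]
    split_ifs <;> simp [AHat.symb_a, mul_assoc, pow_two]
  | succ n =>
    rw [cf_opA, sum_eq_single (1, n)]
    · funext j
      simp [AHat.symb_a]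
    · rintro ⟨p, q⟩ hp hne
      have hp' := HasAntidiagonal.mem_antidiagonal.1 hp
      rw [AHat.symb_a, if_neg, map_zero, LinearMap.zero_apply]
      rintro rfl
      exact hne (by simp at hp' ⊢; omega)
    · intro h
      exact absurd (HasAntidiagonal.mem_antidiagonal.2 (by simp [add_comm])) h

theorem bSeries_smul (S : PowerSeries ℂ) (v : Xi lam N) (k : Fin (N + 1)) :
    (AHat.bSeries S • v) k = S * v k := by
  ext n
  have h := congrFun (cf_smul (AHat.bSeries S) n v) k
  rw [Finset.sum_apply] at h
  rw [PowerSeries.coeff_mul]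
  refine h.trans (sum_congr rfl fun p _ => ?_)
  change (Polynomial.aeval (opD lam N) (AHat.symb (AHat.bFun S) p.1 p.2) (cf p.2 v)) k = _
  rw [AHat.symb_bFun]
  simp [cf]

end Xi

/-- Semi-simplicity of a `[lam]`-primitive fresco, `0 < lam ≤ 1`: every `Â`-linear map to some
`Ξ_lam^{(N)}` has rank at most one. -/
def IsSemisimpleFresco.{u} (lam : ℚ) (E : Type u) [AddCommGroup E] [Module AHat E] : Prop :=
  ∀ (N : ℕ) (φ : E →ₗ[AHat] Xi (lam : ℂ) N), abRank (LinearMap.range φ) ≤ 1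

/-- `P_γ = (a - l₁ b) (1 + γ b)⁻¹ (a - l₂ b) (a - l₃ b)` with `l₂ = l₁ + p₁ - 1` and
`l₃ = l₂ + p₂ - 1`. -/
def PGamma (l₁ : ℚ) (p₁ p₂ : ℕ) (γ : ℂ) : AHat :=
  lin (l₁ : ℂ) * AHat.bSeries (1 + PowerSeries.C γ * PowerSeries.X)⁻¹ *
    lin ((l₁ : ℂ) + p₁ - 1) * lin ((l₁ : ℂ) + p₁ - 1 + p₂ - 1)

/-- `E(γ) = Â / Â P_γ`. -/
abbrev EGamma (l₁ : ℚ) (p₁ p₂ : ℕ) (γ : ℂ) : Type :=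
  AHat ⧸ Submodule.span AHat {PGamma l₁ p₁ p₂ γ}

end Fresco

end

noncomputable section

namespace Fresco

open Finset

namespace AHat

/-! ### Symbols and division by `a - μ b` -/

/-! Right division by `a - μ b` in `Â`, with remainder in `ℂ⟦b⟧`, shows that a monogenic module
filtered by `E_{μ₁}, E_{μ₂}, E_{μ₃}` has a `ℂ⟦b⟧`-basis `e₁, e₂, e₃` with `(a - μ₃ b) e₃ = T e₂`,
`(a - μ₂ b) e₂ = S e₁`, `(a - μ₁ b) e₁ = 0`, where `S` and `T` are invertible series
(`HasFundamentalInvariants.exists_isTower`). Such a module is `Â / Â P` for an explicit `P`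
(`IsTower.exists_equiv`), so everything reduces to the pair `(S, T)` and to changes of basis. These
are governed by `delta c : S ↦ b² S' + c b S`, which multiplies the coefficient of `b^n` by `n + c`
and shifts it by one degree. An equation `delta c S = R` is therefore obstructed only by the
constant term of `R` and by one resonant coefficient, at `n = -c`.

For the exponents at hand the resonances sit at the coefficient of `b^{p₂}` in `T` and at those of
`b^{p₁}` and `b^{p₁+p₂}` in `S`. Semi-simplicity kills exactly these: a map to `Ξ_λ^{(2)}` can be
built step by step, each resonant coefficient reappears as the coefficient of a logarithmic vector,
and rank at most one forbids that vector (`IsTower.coeff_T_eq_zero`, `IsTower.coeff_S_eq_zero`).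
Then `T` is normalized to `1` and `S` to `1 + γ b` (`IsTower.exists_change_T_eq_one`,
`IsTower.exists_change_S_eq`).

Under the changes `e₃ ↦ e₃ + v e₂ + w e₁` that keep `T = 1`, the parameter `γ` moves only through
the constant term of `v`. If `p₂ ≥ 2`, that term must vanish, so `γ` is an invariant
(`isEmpty_equiv_EGamma`). If `p₂ = 1`, then `μ₂ = μ₃`, the constant term is free, and it can be
chosen to remove `γ` (`equiv_EGamma_zero`). -/

theorem asc_comp (i s : ℕ) : asc i s = (asc i 0).comp (Polynomial.X + Polynomial.C (s : ℂ)) := by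
  have h : ∀ t, asc i (t + s) = (asc i t).comp (Polynomial.X + Polynomial.C (s : ℂ)) := by
    induction i with
    | zero => simp [asc]
    | succ i ih =>
      intro t
      rw [asc, asc, Polynomial.mul_comp, ← ih (t + 1), show t + s + 1 = t + 1 + s by ring]
      exact congrArg (· * _) (by simp; ring)
  simpa using h 0

theorem symb_comp (x : AHat) (e f : ℕ) :
    symb x e f = (symb x e 0).comp (Polynomial.X + Polynomial.C (f : ℂ)) := by
  unfold symb
  rw [Polynomial.sum_comp]
  refine sum_congr rfl fun p _ => ?_
  rw [Polynomial.smul_comp, asc_comp p.1 (f + p.2), asc_comp p.1 (0 + p.2), Polynomial.comp_assoc]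
  simp [add_comm, add_left_comm, add_assoc]

/-- Moving from degree `0` to degree `f` is the substitution `X ↦ X + f`, which is injective on
polynomials. -/
theorem ext_symb_of {x y : AHat} (f : ℕ) (h : ∀ e, symb x e f = symb y e f) : x = y := by
  refine ext_symb fun e => ?_
  have := h e
  rw [symb_comp x, symb_comp y] at this
  rw [← sub_eq_zero] at this ⊢
  rwa [← Polynomial.sub_comp, Polynomial.comp_X_add_C_eq_zero_iff] at this

theorem degree_symb_le (x : AHat) (e f : ℕ) : (symb x e f).degree ≤ e := by
  unfold symb
  refine (Polynomial.degree_sum_le _ _).trans (Finset.sup_le fun p hp => ?_)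
  refine (Polynomial.degree_smul_le _ _).trans ?_
  rw [natDegree_asc]
  have := HasAntidiagonal.mem_antidiagonal.1 hp
  exact_mod_cast (by omega : p.1 ≤ e)

/-- The polynomials `asc k (f + (e - k))`, `k ≤ e`, have degrees `0, …, e`, hence span the
polynomials of degree at most `e`. With `ext_symb_of` and `degree_symb_le`, this makes `Â` the set
of all sequences of polynomials with this degree bound. -/
theorem exists_symb_eq (f : ℕ) (p : ℕ → Polynomial ℂ) (hp : ∀ e, (p e).degree ≤ e) :
    ∃ x : AHat, ∀ e, symb x e f = p e := by
  have key : ∀ e, ∃ c : ℕ → ℂ, ∑ q ∈ antidiagonal e, c q.1 • asc q.1 (f + q.2) = p e := by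
    intro e
    let Q : Polynomial.Sequence ℂ := ⟨fun k => asc k (f + (e - k)), fun k => natDegree_asc _ _⟩
    have hs := Q.span_degreeLE (m := e) (fun i _ => (isUnit_iff_ne_zero.2 (by simp)))
    have hm : p e ∈ Submodule.span ℂ (Q '' Set.Iic e) := by
      rw [hs]
      exact Polynomial.mem_degreeLE.2 (hp e)
    have hI : Set.Iic e = ((range (e + 1) : Finset ℕ) : Set ℕ) := by
      ext; simp
    rw [hI, Submodule.mem_span_image_finset_iff_exists_fun'] at hm
    obtain ⟨c, hc⟩ := hm
    refine ⟨c, ?_⟩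
    rw [Nat.sum_antidiagonal_eq_sum_range_succ_mk, ← hc]
  choose c hc using key
  -- The monomial `a^i b^n` is homogeneous of degree `i + n`, so its coefficient is read off from
  -- the expansion in that degree.
  refine ⟨fun n => PowerSeries.mk fun i => c (i + n) i, fun e => ?_⟩
  rw [← hc e]
  unfold symb
  refine sum_congr rfl fun q hq => ?_
  rw [PowerSeries.coeff_mk, HasAntidiagonal.mem_antidiagonal.1 hq]

theorem symb_bSeries (S : PowerSeries ℂ) (e f : ℕ) :
    symb (bSeries S) e f = Polynomial.C (PowerSeries.coeff e S) := symb_bFun S e f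

theorem symb_neg (x : AHat) (e f : ℕ) : symb (-x) e f = -symb x e f := by
  refine eq_neg_of_add_eq_zero_left ?_
  rw [← symb_add, neg_add_cancel, symb_zero]

theorem symb_sub (x y : AHat) (e f : ℕ) : symb (x - y) e f = symb x e f - symb y e f := by
  rw [sub_eq_add_neg, symb_add, symb_neg, sub_eq_add_neg]

theorem a_mul_bSeries (S : PowerSeries ℂ) :
    a * bSeries S = bSeries S * a + bSeries (PowerSeries.X ^ 2 * PowerSeries.derivative ℂ S) := by
  refine ext_symb fun e => ?_
  rw [symb_add, symb_mul, symb_mul, symb_bSeries]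
  cases e with
  | zero => simp [symb_a, pow_two, mul_assoc]
  | succ e =>
    have h1 : ∑ p ∈ antidiagonal (e + 1), symb a p.1 (0 + p.2) * symb (bSeries S) p.2 0 =
        (Polynomial.X + (e : Polynomial ℂ)) * Polynomial.C (PowerSeries.coeff e S) := by
      rw [sum_eq_single (1, e)]
      · simp [symb_a, symb_bSeries]
      · rintro ⟨p, q⟩ hp hne
        have := HasAntidiagonal.mem_antidiagonal.1 hp
        rw [symb_a, if_neg, zero_mul]
        rintro rfl
        exact hne (by simp at this ⊢; omega)
      · intro h
        exact absurd (HasAntidiagonal.mem_antidiagonal.2 (by simp [add_comm])) h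
    have h2 : ∑ p ∈ antidiagonal (e + 1), symb (bSeries S) p.1 (0 + p.2) * symb a p.2 0 =
        Polynomial.C (PowerSeries.coeff e S) * Polynomial.X := by
      rw [sum_eq_single (e, 1)]
      · simp [symb_a, symb_bSeries]
      · rintro ⟨p, q⟩ hp hne
        have := HasAntidiagonal.mem_antidiagonal.1 hp
        rw [symb_a, if_neg, mul_zero]
        rintro rfl
        exact hne (by simp at this ⊢; omega)
      · intro h
        exact absurd (HasAntidiagonal.mem_antidiagonal.2 (by simp)) h
    rw [h1, h2, pow_two, mul_assoc, PowerSeries.coeff_succ_X_mul]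
    cases e with
    | zero => simp
    | succ e =>
      rw [PowerSeries.coeff_succ_X_mul, PowerSeries.coeff_derivative]
      simp
      ring

end AHat

/-! ### The operator `delta` and the commutation of `a - μ b` with series in `b` -/

open AHat

/-- The operator `S ↦ b² S' + c b S`, which describes the action of `a - μ b` on `S(b) x` when
`(a - (μ + c) b) x = 0`. -/
def delta (c : ℂ) (S : PowerSeries ℂ) : PowerSeries ℂ :=
  PowerSeries.X ^ 2 * PowerSeries.derivative ℂ S + PowerSeries.C c * PowerSeries.X * S

theorem coeff_delta_succ (c : ℂ) (S : PowerSeries ℂ) (n : ℕ) :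
    PowerSeries.coeff (n + 1) (delta c S) = (n + c) * PowerSeries.coeff n S := by
  rw [delta, map_add, pow_two, mul_assoc, mul_assoc, PowerSeries.coeff_succ_X_mul,
    PowerSeries.coeff_C_mul, PowerSeries.coeff_succ_X_mul]
  cases n with
  | zero => simp
  | succ n =>
    rw [PowerSeries.coeff_succ_X_mul, PowerSeries.coeff_derivative]
    push_cast
    ring

theorem coeff_delta_zero (c : ℂ) (S : PowerSeries ℂ) :
    PowerSeries.coeff 0 (delta c S) = 0 := by
  simp [delta, pow_two, mul_assoc]

theorem delta_X_pow (c : ℂ) (m : ℕ) :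
    delta c (PowerSeries.X ^ m) = PowerSeries.C ((m : ℂ) + c) * PowerSeries.X ^ (m + 1) := by
  ext n
  cases n with
  | zero => simp [coeff_delta_zero]
  | succ n =>
    rw [coeff_delta_succ, PowerSeries.coeff_C_mul, PowerSeries.coeff_X_pow, PowerSeries.coeff_X_pow]
    by_cases h : n = m
    · simp [h]
    · simp [h]

theorem delta_C_mul (c t : ℂ) (S : PowerSeries ℂ) :
    delta c (PowerSeries.C t * S) = PowerSeries.C t * delta c S := by
  ext n
  cases n with
  | zero => simp [coeff_delta_zero]
  | succ n => simp only [coeff_delta_succ, PowerSeries.coeff_C_mul]; ring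

theorem delta_C (c t : ℂ) : delta c (PowerSeries.C t) = PowerSeries.C (t * c) * PowerSeries.X := by
  have h := delta_C_mul c t (PowerSeries.X ^ 0)
  rw [delta_X_pow] at h
  simpa [mul_assoc] using h

@[simp] theorem delta_zero (c : ℂ) : delta c 0 = 0 := by simp [delta]

/-- Solutions of `b² S' + c b S = R`. -/
theorem exists_delta_eq (c : ℂ) (R : PowerSeries ℂ) (h0 : PowerSeries.coeff 0 R = 0)
    (h : ∀ n : ℕ, (n : ℂ) + c = 0 → PowerSeries.coeff (n + 1) R = 0) : ∃ S, delta c S = R := by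
  -- At a resonant index the quotient is `0` by convention; any value would do there.
  refine ⟨PowerSeries.mk fun n => PowerSeries.coeff (n + 1) R / (n + c), ?_⟩
  ext n
  cases n with
  | zero => rw [coeff_delta_zero, h0]
  | succ n =>
    rw [coeff_delta_succ, PowerSeries.coeff_mk]
    by_cases hn : (n : ℂ) + c = 0
    · rw [hn, h n hn, zero_mul]
    · field_simp

theorem coeff_eq_zero_of_delta_eq_zero {c : ℂ} {S : PowerSeries ℂ} (h : delta c S = 0) (n : ℕ)
    (hn : (n : ℂ) + c ≠ 0) : PowerSeries.coeff n S = 0 := by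
  have := coeff_delta_succ c S n
  rw [h, map_zero] at this
  exact (mul_eq_zero.1 this.symm).resolve_left hn

theorem eq_zero_of_delta_eq_zero {c : ℂ} {S : PowerSeries ℂ} (h : delta c S = 0)
    (hc : ∀ n : ℕ, (n : ℂ) + c ≠ 0) : S = 0 := by
  ext n
  exact coeff_eq_zero_of_delta_eq_zero h n (hc n)

theorem eq_C_of_delta_zero_eq_zero {S : PowerSeries ℂ} (h : delta 0 S = 0) :
    S = PowerSeries.C (PowerSeries.coeff 0 S) := by
  ext n
  rw [PowerSeries.coeff_C]
  split_ifs with hn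
  · rw [hn]
  · exact coeff_eq_zero_of_delta_eq_zero h n (by simpa using hn)

theorem lin_eq (μ : ℂ) : lin μ = a - bSeries (PowerSeries.C μ * PowerSeries.X) := by
  rw [lin, b, ← map_mul]

theorem lin_mul_bSeries (μ ν : ℂ) (S : PowerSeries ℂ) :
    lin μ * bSeries S = bSeries S * lin ν + bSeries (delta (ν - μ) S) := by
  rw [lin_eq, lin_eq, sub_mul, a_mul_bSeries, mul_sub, ← map_mul, ← map_mul, add_sub_assoc,
    ← map_sub, sub_add_eq_add_sub, add_sub_assoc, ← map_sub, delta]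
  congr 2
  rw [map_sub]
  ring

theorem symb_lin (μ : ℂ) (e f : ℕ) :
    symb (lin μ) e f = if e = 1 then Polynomial.X + (f : Polynomial ℂ) - Polynomial.C μ else 0 := by
  rw [lin_eq, symb_sub, symb_a, symb_bSeries, PowerSeries.coeff_C_mul, PowerSeries.coeff_X]
  split_ifs <;> simp

/-- `lin μ` is homogeneous of degree one. Right multiplication by it is thus, degree by degree,
multiplication by the polynomial `X - μ`, and right division becomes polynomial division. -/
theorem symb_mul_lin_succ (x : AHat) (μ : ℂ) (e : ℕ) :
    symb (x * lin μ) (e + 1) 0 = symb x e 1 * (Polynomial.X - Polynomial.C μ) := by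
  rw [symb_mul, sum_eq_single (e, 1)]
  · simp [symb_lin]
  · rintro ⟨p, q⟩ hp hne
    have := HasAntidiagonal.mem_antidiagonal.1 hp
    rw [symb_lin, if_neg, mul_zero]
    rintro rfl
    exact hne (by simp at this ⊢; omega)
  · intro h
    exact absurd (HasAntidiagonal.mem_antidiagonal.2 (by simp)) h

theorem symb_mul_lin_zero (x : AHat) (μ : ℂ) : symb (x * lin μ) 0 0 = 0 := by
  simp [symb_mul, symb_lin]

/-- Division by `a - μ b` on the right. -/
theorem exists_eq_mul_lin_add (x : AHat) (μ : ℂ) :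
    ∃ (q : AHat) (S : PowerSeries ℂ), x = q * lin μ + bSeries S := by
  obtain ⟨q, hq⟩ := exists_symb_eq 1
    (fun e => symb x (e + 1) 0 /ₘ (Polynomial.X - Polynomial.C μ)) (fun e => by
      refine Polynomial.degree_le_of_natDegree_le ?_
      rw [Polynomial.natDegree_divByMonic _ (Polynomial.monic_X_sub_C μ),
        Polynomial.natDegree_X_sub_C]
      have := Polynomial.natDegree_le_of_degree_le (degree_symb_le x (e + 1) 0)
      omega)
  -- The remainder modulo `X - μ` is the value at `μ`, a constant in each degree; constants in all
  -- degrees are exactly the symbols of a series in `b`.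
  refine ⟨q, PowerSeries.mk fun e => (symb x e 0).eval μ, ext_symb fun e => ?_⟩
  rw [symb_add, symb_bSeries, PowerSeries.coeff_mk]
  cases e with
  | zero =>
    rw [symb_mul_lin_zero, zero_add]
    have h := Polynomial.eq_C_of_degree_le_zero (degree_symb_le x 0 0)
    rw [h, Polynomial.eval_C]
  | succ e =>
    have := Polynomial.modByMonic_add_div (symb x (e + 1) 0) (Polynomial.X - Polynomial.C μ)
    rw [Polynomial.modByMonic_X_sub_C_eq_C_eval] at this
    rw [symb_mul_lin_succ, hq, mul_comm, add_comm (_ * _), this]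

theorem eq_zero_of_mul_lin_add_eq_zero {q : AHat} {S : PowerSeries ℂ} {μ : ℂ}
    (h : q * lin μ + bSeries S = 0) : q = 0 ∧ S = 0 := by
  have hs : ∀ e, symb (q * lin μ) e 0 + Polynomial.C (PowerSeries.coeff e S) = 0 := by
    intro e
    rw [← symb_bSeries S e 0, ← symb_add, h, symb_zero]
  have hS : S = 0 := by
    ext e
    have := congrArg (Polynomial.eval μ) (hs e)
    cases e with
    | zero => simpa [symb_mul_lin_zero] using this
    | succ e => simpa [symb_mul_lin_succ] using this
  refine ⟨ext_symb_of 1 fun e => ?_, hS⟩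
  have := hs (e + 1)
  rw [hS, map_zero, map_zero, add_zero, symb_mul_lin_succ] at this
  rw [symb_zero]
  exact (mul_eq_zero.1 this).resolve_right (Polynomial.X_sub_C_ne_zero μ)

/-- Multiplicativity of the constant term; it serves to detect that the leading series of a
generator is invertible. -/
theorem symb_zero_mul (x y : AHat) : symb (x * y) 0 0 = symb x 0 0 * symb y 0 0 := by
  simp [symb_mul]

theorem bSeries_mul_inv {S : PowerSeries ℂ} (hS : PowerSeries.coeff 0 S ≠ 0) :
    bSeries S * bSeries S⁻¹ = 1 := by
  rw [← map_mul, PowerSeries.mul_inv_cancel _ (by simpa using hS), map_one]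

theorem bSeries_inv_mul {S : PowerSeries ℂ} (hS : PowerSeries.coeff 0 S ≠ 0) :
    bSeries S⁻¹ * bSeries S = 1 := by
  rw [← map_mul, PowerSeries.inv_mul_cancel _ (by simpa using hS), map_one]

theorem bSeries_inv_smul {E : Type*} [AddCommGroup E] [Module AHat E] {S : PowerSeries ℂ}
    (hS : PowerSeries.coeff 0 S ≠ 0) {x y : E} (h : x = bSeries S • y) : bSeries S⁻¹ • x = y := by
  rw [h, smul_smul, bSeries_inv_mul hS, one_smul]

theorem lin_smul_bSeries_smul {E : Type*} [AddCommGroup E] [Module AHat E] (μ ν : ℂ)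
    (S : PowerSeries ℂ) (x : E) :
    lin μ • bSeries S • x = bSeries S • lin ν • x + bSeries (delta (ν - μ) S) • x := by
  rw [smul_smul, lin_mul_bSeries μ ν, add_smul, smul_smul]

/-! ### Standard bases of modules of rank three -/

/-- `e₁, e₂, e₃` is a `ℂ⟦b⟧`-basis of `E` with `(a - μ₃ b) e₃ = T e₂`, `(a - μ₂ b) e₂ = S e₁`,
`(a - μ₁ b) e₁ = 0`, where `S` and `T` are invertible. -/
structure IsTower {E : Type*} [AddCommGroup E] [Module AHat E] (μ₁ μ₂ μ₃ : ℂ)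
    (S T : PowerSeries ℂ) (e₁ e₂ e₃ : E) : Prop where
  lin_three : lin μ₃ • e₃ = bSeries T • e₂
  lin_two : lin μ₂ • e₂ = bSeries S • e₁
  lin_one : lin μ₁ • e₁ = 0
  span : ∀ x, ∃ u v w, x = bSeries u • e₃ + bSeries v • e₂ + bSeries w • e₁
  indep : ∀ u v w, bSeries u • e₃ + bSeries v • e₂ + bSeries w • e₁ = 0 → u = 0 ∧ v = 0 ∧ w = 0
  coeff_S : PowerSeries.coeff 0 S ≠ 0
  coeff_T : PowerSeries.coeff 0 T ≠ 0

/-- `(a - μ₁ b) S⁻¹ (a - μ₂ b) T⁻¹ (a - μ₃ b)`. -/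
def towerPoly (μ₁ μ₂ μ₃ : ℂ) (S T : PowerSeries ℂ) : AHat :=
  lin μ₁ * bSeries S⁻¹ * lin μ₂ * bSeries T⁻¹ * lin μ₃

/-- Three successive right divisions, by `lin μ₃`, `lin μ₂` and `lin μ₁`, with the units `T` and `S`
moved into the quotients before the second and the third. -/
theorem exists_eq_mul_towerPoly_add {S T : PowerSeries ℂ} (μ₁ μ₂ μ₃ : ℂ)
    (hS : PowerSeries.coeff 0 S ≠ 0) (hT : PowerSeries.coeff 0 T ≠ 0) (x : AHat) :
    ∃ (q : AHat) (u v w : PowerSeries ℂ), x = q * towerPoly μ₁ μ₂ μ₃ S T + bSeries u +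
      bSeries v * (bSeries T⁻¹ * lin μ₃) +
      bSeries w * (bSeries S⁻¹ * lin μ₂ * bSeries T⁻¹ * lin μ₃) := by
  obtain ⟨q₃, u, rfl⟩ := exists_eq_mul_lin_add x μ₃
  obtain ⟨q₂, v, h₂⟩ := exists_eq_mul_lin_add (q₃ * bSeries T) μ₂
  obtain ⟨q₁, w, h₁⟩ := exists_eq_mul_lin_add (q₂ * bSeries S) μ₁
  refine ⟨q₁, u, v, w, ?_⟩
  have h₃ : q₃ = (q₂ * lin μ₂ + bSeries v) * bSeries T⁻¹ := by
    rw [← h₂, mul_assoc, bSeries_mul_inv hT, mul_one]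
  have h₄ : q₂ = (q₁ * lin μ₁ + bSeries w) * bSeries S⁻¹ := by
    rw [← h₁, mul_assoc, bSeries_mul_inv hS, mul_one]
  rw [h₃, h₄, towerPoly]
  noncomm_ring

theorem eq_zero_of_mem_span_towerPoly {S T : PowerSeries ℂ} {μ₁ μ₂ μ₃ : ℂ}
    (hS : PowerSeries.coeff 0 S ≠ 0) (hT : PowerSeries.coeff 0 T ≠ 0) {u v w : PowerSeries ℂ}
    {q : AHat} (h : q * towerPoly μ₁ μ₂ μ₃ S T + bSeries u +
      bSeries v * (bSeries T⁻¹ * lin μ₃) +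
      bSeries w * (bSeries S⁻¹ * lin μ₂ * bSeries T⁻¹ * lin μ₃) = 0) : u = 0 ∧ v = 0 ∧ w = 0 := by
  have cancel : ∀ {R : PowerSeries ℂ} {x : AHat}, PowerSeries.coeff 0 R ≠ 0 →
      x * bSeries R⁻¹ = 0 → x = 0 := by
    intro R x hR hx
    have := congrArg (· * bSeries R) hx
    simpa [mul_assoc, bSeries_inv_mul hR] using this
  have h₃ : (((q * lin μ₁ + bSeries w) * bSeries S⁻¹ * lin μ₂ + bSeries v) * bSeries T⁻¹) * lin μ₃ +
      bSeries u = 0 := by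
    rw [← h, towerPoly]
    noncomm_ring
  obtain ⟨h₂, hu⟩ := eq_zero_of_mul_lin_add_eq_zero h₃
  obtain ⟨h₁, hv⟩ := eq_zero_of_mul_lin_add_eq_zero (cancel hT h₂)
  exact ⟨hu, hv, (eq_zero_of_mul_lin_add_eq_zero (cancel hS h₁)).2⟩

theorem symb_mul_towerPoly (μ₁ μ₂ μ₃ : ℂ) (S T : PowerSeries ℂ) (q : AHat) :
    symb (q * towerPoly μ₁ μ₂ μ₃ S T) 0 0 = 0 := by
  rw [towerPoly, ← mul_assoc, symb_mul_lin_zero]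

namespace IsTower

variable {E : Type*} [AddCommGroup E] [Module AHat E] {μ₁ μ₂ μ₃ : ℂ}
  {S T : PowerSeries ℂ} {e₁ e₂ e₃ : E}

theorem smul_two (h : IsTower μ₁ μ₂ μ₃ S T e₁ e₂ e₃) : (bSeries T⁻¹ * lin μ₃) • e₃ = e₂ := by
  rw [mul_smul, bSeries_inv_smul h.coeff_T h.lin_three]

theorem smul_one (h : IsTower μ₁ μ₂ μ₃ S T e₁ e₂ e₃) :
    (bSeries S⁻¹ * lin μ₂ * bSeries T⁻¹ * lin μ₃) • e₃ = e₁ := by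
  rw [mul_assoc, mul_smul, h.smul_two, mul_smul, bSeries_inv_smul h.coeff_S h.lin_two]

theorem towerPoly_smul (h : IsTower μ₁ μ₂ μ₃ S T e₁ e₂ e₃) :
    towerPoly μ₁ μ₂ μ₃ S T • e₃ = 0 := by
  rw [towerPoly, mul_assoc, mul_assoc, mul_assoc, mul_smul, ← mul_assoc, ← mul_assoc, h.smul_one,
    h.lin_one]

theorem smul_eq (h : IsTower μ₁ μ₂ μ₃ S T e₁ e₂ e₃) (q : AHat) (u v w : PowerSeries ℂ) :
    (q * towerPoly μ₁ μ₂ μ₃ S T + bSeries u + bSeries v * (bSeries T⁻¹ * lin μ₃) +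
      bSeries w * (bSeries S⁻¹ * lin μ₂ * bSeries T⁻¹ * lin μ₃)) • e₃ =
      bSeries u • e₃ + bSeries v • e₂ + bSeries w • e₁ := by
  rw [add_smul, add_smul, add_smul, mul_smul, h.towerPoly_smul, mul_smul, h.smul_two, mul_smul,
    h.smul_one, smul_zero, zero_add]

theorem exists_mul_of_smul_eq_zero (h : IsTower μ₁ μ₂ μ₃ S T e₁ e₂ e₃) {x : AHat}
    (hx : x • e₃ = 0) : ∃ q, x = q * towerPoly μ₁ μ₂ μ₃ S T := by
  obtain ⟨q, u, v, w, rfl⟩ := exists_eq_mul_towerPoly_add μ₁ μ₂ μ₃ h.coeff_S h.coeff_T x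
  rw [h.smul_eq] at hx
  obtain ⟨rfl, rfl, rfl⟩ := h.indep _ _ _ hx
  exact ⟨q, by simp⟩

theorem exists_smul_eq (h : IsTower μ₁ μ₂ μ₃ S T e₁ e₂ e₃) (y : E) : ∃ x : AHat, y = x • e₃ := by
  obtain ⟨u, v, w, hy⟩ := h.span y
  exact ⟨_, hy.trans (h.smul_eq 0 u v w).symm⟩

/-- A module with a standard basis is `Â / Â P`. -/
theorem exists_equiv (h : IsTower μ₁ μ₂ μ₃ S T e₁ e₂ e₃) :
    ∃ φ : (AHat ⧸ Submodule.span AHat {towerPoly μ₁ μ₂ μ₃ S T}) ≃ₗ[AHat] E,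
      ∀ x, φ (Submodule.Quotient.mk x) = x • e₃ := by
  have hk : Submodule.span AHat {towerPoly μ₁ μ₂ μ₃ S T} =
      LinearMap.ker (LinearMap.toSpanSingleton AHat E e₃) := by
    ext x
    rw [Submodule.mem_span_singleton, LinearMap.mem_ker, LinearMap.toSpanSingleton_apply]
    constructor
    · rintro ⟨q, rfl⟩
      rw [smul_assoc, h.towerPoly_smul, smul_zero]
    · intro hx
      obtain ⟨q, rfl⟩ := h.exists_mul_of_smul_eq_zero hx
      exact ⟨q, rfl⟩
  rw [hk]
  exact ⟨(LinearMap.toSpanSingleton AHat E e₃).quotKerEquivOfSurjective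
    (fun y => (h.exists_smul_eq y).imp fun x hx => hx.symm), fun x => rfl⟩

/-- As `E` is `Â / Â P`, a map is the choice of an element killed by `P`. Since `S` and `T` are
invertible, the three relations recover `f₂` and `f₁` from `f₃` and give `P f₃ = 0`. -/
theorem exists_hom (h : IsTower μ₁ μ₂ μ₃ S T e₁ e₂ e₃) {M : Type*} [AddCommGroup M] [Module AHat M]
    {f₁ f₂ f₃ : M} (h₃ : lin μ₃ • f₃ = bSeries T • f₂) (h₂ : lin μ₂ • f₂ = bSeries S • f₁)
    (h₁ : lin μ₁ • f₁ = 0) : ∃ φ : E →ₗ[AHat] M, φ e₁ = f₁ ∧ φ e₂ = f₂ ∧ φ e₃ = f₃ := by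
  obtain ⟨ψ, hψ⟩ := h.exists_equiv
  have k₂ : (bSeries T⁻¹ * lin μ₃) • f₃ = f₂ := by
    rw [mul_smul, bSeries_inv_smul h.coeff_T h₃]
  have k₁ : (bSeries S⁻¹ * lin μ₂ * bSeries T⁻¹ * lin μ₃) • f₃ = f₁ := by
    rw [mul_assoc, mul_smul, k₂, mul_smul, bSeries_inv_smul h.coeff_S h₂]
  have k₀ : towerPoly μ₁ μ₂ μ₃ S T • f₃ = 0 := by
    rw [towerPoly, mul_assoc, mul_assoc, mul_assoc, mul_smul, ← mul_assoc, ← mul_assoc, k₁, h₁]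
  let φ := (Submodule.liftQ (Submodule.span AHat {towerPoly μ₁ μ₂ μ₃ S T})
    (LinearMap.toSpanSingleton AHat M f₃) (by
      rw [Submodule.span_singleton_le_iff_mem, LinearMap.mem_ker, LinearMap.toSpanSingleton_apply,
        k₀])).comp ψ.symm.toLinearMap
  have hφ : φ e₃ = f₃ := by
    have : ψ.symm e₃ = Submodule.Quotient.mk 1 := by
      rw [LinearEquiv.symm_apply_eq, hψ, _root_.one_smul]
    simp [φ, this]
  refine ⟨φ, ?_, ?_, hφ⟩
  · rw [← h.smul_one, map_smul, hφ, k₁]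
  · rw [← h.smul_two, map_smul, hφ, k₂]

end IsTower

theorem isTower_quotient (μ₁ μ₂ μ₃ : ℂ) {S T : PowerSeries ℂ}
    (hS : PowerSeries.coeff 0 S ≠ 0) (hT : PowerSeries.coeff 0 T ≠ 0) :
    ∃ e₁ e₂ : AHat ⧸ Submodule.span AHat {towerPoly μ₁ μ₂ μ₃ S T},
      IsTower μ₁ μ₂ μ₃ S T e₁ e₂ (Submodule.Quotient.mk 1) := by
  have hP : towerPoly μ₁ μ₂ μ₃ S T = lin μ₁ * (bSeries S⁻¹ * lin μ₂ * bSeries T⁻¹ * lin μ₃) := by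
    rw [towerPoly]
    noncomm_ring
  have comb : ∀ u v w : PowerSeries ℂ, (Submodule.Quotient.mk (bSeries u +
      bSeries v * (bSeries T⁻¹ * lin μ₃) +
      bSeries w * (bSeries S⁻¹ * lin μ₂ * bSeries T⁻¹ * lin μ₃)) :
        AHat ⧸ Submodule.span AHat {towerPoly μ₁ μ₂ μ₃ S T}) =
      bSeries u • Submodule.Quotient.mk 1 + bSeries v • Submodule.Quotient.mk (bSeries T⁻¹ * lin μ₃)
      + bSeries w • Submodule.Quotient.mk (bSeries S⁻¹ * lin μ₂ * bSeries T⁻¹ * lin μ₃) := by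
    intro u v w
    rw [← Submodule.Quotient.mk_smul, ← Submodule.Quotient.mk_smul, ← Submodule.Quotient.mk_smul,
      ← Submodule.Quotient.mk_add, ← Submodule.Quotient.mk_add, smul_eq_mul, smul_eq_mul,
      smul_eq_mul, mul_one]
  refine ⟨Submodule.Quotient.mk (bSeries S⁻¹ * lin μ₂ * bSeries T⁻¹ * lin μ₃),
    Submodule.Quotient.mk (bSeries T⁻¹ * lin μ₃), ?_, ?_, ?_, ?_, ?_, hS, hT⟩
  · rw [← Submodule.Quotient.mk_smul, ← Submodule.Quotient.mk_smul, smul_eq_mul, smul_eq_mul,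
      ← mul_assoc, bSeries_mul_inv hT, mul_one, one_mul]
  · rw [← Submodule.Quotient.mk_smul, ← Submodule.Quotient.mk_smul, smul_eq_mul, smul_eq_mul,
      mul_assoc, mul_assoc, ← mul_assoc (bSeries S), bSeries_mul_inv hS, one_mul]
  · rw [← Submodule.Quotient.mk_smul, smul_eq_mul, ← hP, Submodule.Quotient.mk_eq_zero]
    exact Submodule.mem_span_singleton_self _
  · intro x
    obtain ⟨x, rfl⟩ := Submodule.Quotient.mk_surjective _ x
    obtain ⟨q, u, v, w, hx⟩ := exists_eq_mul_towerPoly_add μ₁ μ₂ μ₃ hS hT x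
    refine ⟨u, v, w, ?_⟩
    rw [← comb, Submodule.Quotient.eq, hx]
    exact Submodule.mem_span_singleton.2 ⟨q, by rw [smul_eq_mul]; abel⟩
  · intro u v w h
    rw [← comb, Submodule.Quotient.mk_eq_zero] at h
    obtain ⟨q, hq⟩ := Submodule.mem_span_singleton.1 h
    refine eq_zero_of_mem_span_towerPoly (q := -q) hS hT (μ₁ := μ₁) (μ₂ := μ₂) (μ₃ := μ₃) ?_
    rw [smul_eq_mul] at hq
    rw [neg_mul, hq]
    abel

/-! ### Changes of standard basis and the comparison with `E(γ)` -/

namespace IsTower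

variable {E : Type*} [AddCommGroup E] [Module AHat E] {μ₁ μ₂ μ₃ : ℂ}
  {S T : PowerSeries ℂ} {e₁ e₂ e₃ : E}

theorem lin_smul_comb (h : IsTower μ₁ μ₂ μ₃ S T e₁ e₂ e₃) (μ : ℂ) (u v w : PowerSeries ℂ) :
    lin μ • (bSeries u • e₃ + bSeries v • e₂ + bSeries w • e₁) =
      bSeries (delta (μ₃ - μ) u) • e₃ + bSeries (u * T + delta (μ₂ - μ) v) • e₂ +
        bSeries (v * S + delta (μ₁ - μ) w) • e₁ := by
  rw [smul_add, smul_add, lin_smul_bSeries_smul μ μ₃, lin_smul_bSeries_smul μ μ₂,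
    lin_smul_bSeries_smul μ μ₁, h.lin_one, h.lin_two, h.lin_three]
  simp only [map_add, map_mul, add_smul, mul_smul, smul_zero]
  abel

theorem coeff_unique (h : IsTower μ₁ μ₂ μ₃ S T e₁ e₂ e₃) {u v w u' v' w' : PowerSeries ℂ}
    (he : bSeries u • e₃ + bSeries v • e₂ + bSeries w • e₁ =
      bSeries u' • e₃ + bSeries v' • e₂ + bSeries w' • e₁) : u = u' ∧ v = v' ∧ w = w' := by
  obtain ⟨h1, h2, h3⟩ := h.indep (u - u') (v - v') (w - w') (by
    simp only [map_sub, sub_smul]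
    rw [← sub_eq_zero.2 he]
    abel)
  exact ⟨sub_eq_zero.1 h1, sub_eq_zero.1 h2, sub_eq_zero.1 h3⟩

/-- Change of the standard basis. -/
theorem change (h : IsTower μ₁ μ₂ μ₃ S T e₁ e₂ e₃) {t : ℂ} (ht : t ≠ 0)
    {v w r S' : PowerSeries ℂ}
    (hv : T + delta (μ₂ - μ₃) v = PowerSeries.C t)
    (hr : r = v * S + delta (μ₁ - μ₃) w)
    (hS : S' = PowerSeries.C t * S + delta (μ₁ - μ₂) r) (hS0 : PowerSeries.coeff 0 S' ≠ 0) :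
    IsTower μ₁ μ₂ μ₃ S' 1 e₁ (bSeries (PowerSeries.C t) • e₂ + bSeries r • e₁)
      (e₃ + bSeries v • e₂ + bSeries w • e₁) := by
  have htt : PowerSeries.C t⁻¹ * PowerSeries.C t = 1 := by
    rw [← map_mul, inv_mul_cancel₀ ht, map_one]
  -- The new second vector is `a - μ₃ b` applied to the new third one, with coordinates given by
  -- `hv` and `hr`; applying `a - μ₂ b` to it gives the new `S'` by `hS`.
  refine ⟨?_, ?_, h.lin_one, ?_, ?_, hS0, by simp⟩
  · rw [smul_add, smul_add, lin_smul_bSeries_smul μ₃ μ₂, lin_smul_bSeries_smul μ₃ μ₁, h.lin_one,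
      h.lin_two, h.lin_three, hr, ← hv]
    simp only [map_add, map_mul, map_one, add_smul, mul_smul, smul_zero, _root_.one_smul]
    abel
  · rw [smul_add, lin_smul_bSeries_smul μ₂ μ₂, lin_smul_bSeries_smul μ₂ μ₁, h.lin_one,
      h.lin_two, hS, sub_self, delta_C, mul_zero, map_zero, zero_mul]
    simp only [map_add, map_mul, map_zero, add_smul, mul_smul, smul_zero, zero_smul]
    abel
  · intro x
    obtain ⟨u, v', w', rfl⟩ := h.span x
    refine ⟨u, (v' - u * v) * PowerSeries.C t⁻¹, w' - u * w - (v' - u * v) * PowerSeries.C t⁻¹ * r,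
      ?_⟩
    simp only [smul_add, smul_smul, ← map_mul]
    rw [show (v' - u * v) * PowerSeries.C t⁻¹ * PowerSeries.C t = v' - u * v by
      rw [mul_assoc, htt, mul_one]]
    simp only [map_sub, sub_smul]
    abel
  · intro u v' w' hx
    have hx' : bSeries u • e₃ + bSeries (u * v + v' * PowerSeries.C t) • e₂ +
        bSeries (u * w + v' * r + w') • e₁ = 0 := by
      rw [← hx]
      simp only [map_add, map_mul, add_smul, mul_smul, smul_add]
      abel
    obtain ⟨rfl, h2, h3⟩ := h.indep _ _ _ hx'
    rw [zero_mul, zero_add] at h2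
    have hv' : v' = 0 := by
      refine (mul_eq_zero.1 h2).resolve_right fun h0 => ht ?_
      simpa using congrArg (PowerSeries.coeff 0) h0
    subst hv'
    exact ⟨rfl, rfl, by simpa using h3⟩

theorem rescale (h : IsTower μ₁ μ₂ μ₃ S T e₁ e₂ e₃) {s : ℂ} (hs : s ≠ 0) :
    IsTower μ₁ μ₂ μ₃ (PowerSeries.C s⁻¹ * S) T (bSeries (PowerSeries.C s) • e₁) e₂ e₃ := by
  have hss : PowerSeries.C s⁻¹ * PowerSeries.C s = 1 := by
    rw [← map_mul, inv_mul_cancel₀ hs, map_one]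
  refine ⟨h.lin_three, ?_, ?_, ?_, ?_, ?_, h.coeff_T⟩
  · rw [h.lin_two, smul_smul, ← map_mul, mul_right_comm, hss, one_mul]
  · rw [lin_smul_bSeries_smul μ₁ μ₁, h.lin_one, sub_self, delta_C]
    simp
  · intro x
    obtain ⟨u, v, w, rfl⟩ := h.span x
    refine ⟨u, v, w * PowerSeries.C s⁻¹, ?_⟩
    rw [smul_smul (bSeries (w * _)), ← map_mul, mul_assoc, hss, mul_one]
  · intro u v w hx
    rw [smul_smul, ← map_mul] at hx
    obtain ⟨rfl, rfl, h3⟩ := h.indep _ _ _ hx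
    refine ⟨rfl, rfl, (mul_eq_zero.1 h3).resolve_right fun h0 => hs ?_⟩
    simpa using congrArg (PowerSeries.coeff 0) h0
  · rw [PowerSeries.coeff_C_mul]
    exact mul_ne_zero (inv_ne_zero hs) h.coeff_S

end IsTower

theorem PGamma_eq (l₁ : ℚ) (p₁ p₂ : ℕ) (γ : ℂ) :
    PGamma l₁ p₁ p₂ γ = towerPoly (l₁ : ℂ) ((l₁ : ℂ) + p₁ - 1) ((l₁ : ℂ) + p₁ - 1 + p₂ - 1)
      (1 + PowerSeries.C γ * PowerSeries.X) 1 := by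
  rw [towerPoly, PGamma, show (1 : PowerSeries ℂ)⁻¹ = 1 from inv_one, map_one, mul_one]

theorem coeff_zero_one_add (γ : ℂ) :
    PowerSeries.coeff 0 (1 + PowerSeries.C γ * PowerSeries.X) ≠ 0 := by
  simp

theorem IsTower.equiv_EGamma {E : Type*} [AddCommGroup E] [Module AHat E] {l₁ : ℚ} {p₁ p₂ : ℕ}
    {γ : ℂ} {e₁ e₂ e₃ : E} (h : IsTower (l₁ : ℂ) ((l₁ : ℂ) + p₁ - 1) ((l₁ : ℂ) + p₁ - 1 + p₂ - 1)
      (1 + PowerSeries.C γ * PowerSeries.X) 1 e₁ e₂ e₃) :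
    Nonempty (E ≃ₗ[AHat] EGamma l₁ p₁ p₂ γ) := by
  obtain ⟨φ, -⟩ := h.exists_equiv
  unfold EGamma
  rw [PGamma_eq]
  exact ⟨φ.symm⟩

theorem exists_isTower_EGamma (l₁ : ℚ) (p₁ p₂ : ℕ) (γ : ℂ) :
    ∃ e₁ e₂ : EGamma l₁ p₁ p₂ γ,
      IsTower (l₁ : ℂ) ((l₁ : ℂ) + p₁ - 1) ((l₁ : ℂ) + p₁ - 1 + p₂ - 1)
        (1 + PowerSeries.C γ * PowerSeries.X) 1 e₁ e₂ (Submodule.Quotient.mk 1) := by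
  unfold EGamma
  rw [PGamma_eq]
  exact isTower_quotient _ _ _ (coeff_zero_one_add γ) (by simp)

/-! ### The modules `E(γ)` -/

theorem equiv_EGamma_zero (l₁ : ℚ) {p₁ : ℕ} (hp₁ : 2 ≤ p₁) (γ : ℂ) :
    Nonempty (EGamma l₁ p₁ 1 γ ≃ₗ[AHat] EGamma l₁ p₁ 1 0) := by
  obtain ⟨e₁, e₂, h⟩ := exists_isTower_EGamma l₁ p₁ 1 γ
  have hp : (p₁ : ℂ) - 1 ≠ 0 := by
    rw [sub_ne_zero]
    exact_mod_cast (by omega : p₁ ≠ 1)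
  -- Here `μ₂ = μ₃`, so a constant `v = c` leaves `T = 1` unchanged. The value `w = c²` cancels the
  -- term `cγ b` of `v S`, which leaves `r = c`; the new `S` is then `1 + (γ - (p₁ - 1) c) b`,
  -- whence `c = γ / (p₁ - 1)`.
  have h' := h.change (t := 1) (v := PowerSeries.C (γ / (p₁ - 1)))
    (w := PowerSeries.C ((γ / (p₁ - 1)) ^ 2)) (r := PowerSeries.C (γ / (p₁ - 1)))
    (S' := 1 + PowerSeries.C 0 * PowerSeries.X) one_ne_zero ?_ ?_ ?_ (coeff_zero_one_add 0)
  · exact h'.equiv_EGamma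
  · rw [delta_C]; simp
  · rw [delta_C, mul_add, ← mul_assoc, ← map_mul, mul_one, add_assoc, ← add_mul, ← map_add]
    rw [show γ / (p₁ - 1) * γ + (γ / (p₁ - 1)) ^ 2 * (l₁ - (l₁ + p₁ - 1 + (1 : ℕ) - 1)) = (0 : ℂ) by
      push_cast
      field_simp
      ring]
    simp
  · rw [delta_C, map_one, one_mul, add_assoc, ← add_mul, ← map_add]
    rw [show γ + γ / (p₁ - 1) * (l₁ - (l₁ + p₁ - 1)) = (0 : ℂ) by
      field_simp
      ring]

theorem isEmpty_equiv_EGamma (l₁ : ℚ) {p₁ p₂ : ℕ} (hp₁ : 2 ≤ p₁) (hp₂ : 2 ≤ p₂) {γ γ' : ℂ}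
    (hγ : γ ≠ γ') : IsEmpty (EGamma l₁ p₁ p₂ γ ≃ₗ[AHat] EGamma l₁ p₁ p₂ γ') := by
  refine ⟨fun φ => hγ ?_⟩
  obtain ⟨e₁, e₂, h⟩ := exists_isTower_EGamma l₁ p₁ p₂ γ
  obtain ⟨f₁, f₂, k⟩ := exists_isTower_EGamma l₁ p₁ p₂ γ'
  obtain ⟨u, v, w, huvw⟩ := k.span (φ (Submodule.Quotient.mk 1))
  have hn : ∀ n m : ℕ, 0 < m → (n : ℂ) + m ≠ 0 := fun n m hm => by
    exact_mod_cast (by omega : n + m ≠ 0)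
  -- the constant coefficient of `u` is not zero
  have hu : PowerSeries.coeff 0 u ≠ 0 := by
    obtain ⟨y, hy⟩ := h.exists_smul_eq (φ.symm (Submodule.Quotient.mk 1))
    have hy' : Submodule.Quotient.mk 1 = y • φ (Submodule.Quotient.mk 1) := by
      rw [← map_smul, ← hy, LinearEquiv.apply_symm_apply]
    rw [huvw, ← k.smul_eq 0, smul_smul] at hy'
    have h0 := sub_eq_zero.2 hy'.symm
    nth_rewrite 2 [← _root_.one_smul AHat (Submodule.Quotient.mk 1 : EGamma l₁ p₁ p₂ γ')] at h0
    rw [← sub_smul] at h0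
    obtain ⟨q, hq⟩ := k.exists_mul_of_smul_eq_zero h0
    intro hu0
    -- In degree zero all multiples of some `lin μ` on the right disappear, and a zero constant term
    -- of `u` would give `-1 = 0`.
    have := congrArg (fun z => symb z 0 0) hq
    simp only [symb_mul_towerPoly] at this
    simp only [symb_sub, symb_zero_mul, symb_add, symb_bSeries, symb_lin, symb_one, symb_zero, hu0] at this
    simp at this
  have hP : lin (l₁ : ℂ) • (bSeries (1 + PowerSeries.C γ * PowerSeries.X)⁻¹ *
      lin ((l₁ : ℂ) + p₁ - 1) * lin ((l₁ : ℂ) + p₁ - 1 + p₂ - 1)) •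
        φ (Submodule.Quotient.mk 1) = 0 := by
    have e : lin (l₁ : ℂ) * (bSeries (1 + PowerSeries.C γ * PowerSeries.X)⁻¹ *
        lin ((l₁ : ℂ) + p₁ - 1) * lin ((l₁ : ℂ) + p₁ - 1 + p₂ - 1)) =
        towerPoly (l₁ : ℂ) ((l₁ : ℂ) + p₁ - 1) ((l₁ : ℂ) + p₁ - 1 + p₂ - 1)
          (1 + PowerSeries.C γ * PowerSeries.X) 1 := by
      rw [← PGamma_eq, PGamma]
      noncomm_ring
    rw [smul_smul, e, ← map_smul, h.towerPoly_smul, map_zero]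
  obtain ⟨h₃, h₂, h₁, hh⟩ := k.span ((bSeries (1 + PowerSeries.C γ * PowerSeries.X)⁻¹ *
      lin ((l₁ : ℂ) + p₁ - 1) * lin ((l₁ : ℂ) + p₁ - 1 + p₂ - 1)) • φ (Submodule.Quotient.mk 1))
  rw [hh, k.lin_smul_comb] at hP
  obtain ⟨hP₃, hP₂, hP₁⟩ := k.indep _ _ _ hP
  -- The kernel of `a - λ₁ b` in `E(γ')` is `ℂ f₁`: the exponent differences `p₁ + p₂ - 2` and `p₁ -
  -- 1` are positive, so there is no resonance along `f₃` and `f₂`.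
  have d₃ : h₃ = 0 := eq_zero_of_delta_eq_zero hP₃ fun n => by
    convert hn n (p₁ + p₂ - 2) (by omega) using 1
    push_cast [show 2 ≤ p₁ + p₂ by omega]
    ring
  subst d₃
  rw [zero_mul, zero_add] at hP₂
  have d₂ : h₂ = 0 := eq_zero_of_delta_eq_zero hP₂ fun n => by
    convert hn n (p₁ - 1) (by omega) using 1
    push_cast [show 1 ≤ p₁ by omega]
    ring
  subst d₂
  rw [zero_mul, zero_add, sub_self] at hP₁
  rw [mul_assoc, mul_smul, mul_smul, huvw, k.lin_smul_comb, k.lin_smul_comb] at hh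
  have hh' := congrArg (bSeries (1 + PowerSeries.C γ * PowerSeries.X) • ·) hh
  simp only [smul_add, smul_smul, ← map_mul, ← mul_assoc, mul_zero, one_mul, mul_one,
    PowerSeries.mul_inv_cancel (1 + PowerSeries.C γ * PowerSeries.X) (by simp)] at hh'
  obtain ⟨c₃, c₂, c₁⟩ := k.coeff_unique hh'
  clear hh hh' hP
  rw [eq_C_of_delta_zero_eq_zero hP₁] at c₁
  rw [sub_self] at c₂ c₃
  have hu' := eq_zero_of_delta_eq_zero c₃ fun n => by
    convert hn n (p₂ - 1) (by omega) using 1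
    push_cast [show 1 ≤ p₂ by omega]
    ring
  rw [hu', zero_add, sub_self] at c₂
  have hq := eq_C_of_delta_zero_eq_zero c₂
  rw [map_add, coeff_delta_zero, add_zero] at hq
  -- The `f₂`-coordinate `u + delta (λ₂ - λ₃) v` and `u` are both constant, and the coefficient of
  -- `b` in the former is `-(p₂ - 1)` times the constant term of `v`. This is where `p₂ ≥ 2`
  -- decides.
  have hv : PowerSeries.coeff 0 v = 0 := by
    have h1 := congrArg (PowerSeries.coeff 1) hq
    rw [eq_C_of_delta_zero_eq_zero hu', map_add, coeff_delta_succ] at h1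
    simp only [PowerSeries.coeff_C, one_ne_zero, if_false, zero_add] at h1
    refine (mul_eq_zero.1 h1).resolve_left ?_
    rw [show ((0 : ℕ) : ℂ) + ((l₁ : ℂ) + p₁ - 1 - (l₁ + p₁ - 1 + p₂ - 1)) = -((p₂ : ℂ) - 1) by
      push_cast; ring]
    refine neg_ne_zero.2 (sub_ne_zero.2 ?_)
    exact_mod_cast (by omega : p₂ ≠ 1)
  rw [hq] at c₁
  have a0 : ∀ c : ℂ, PowerSeries.coeff 0 (1 + PowerSeries.C c * PowerSeries.X) = 1 := by simp
  have a1 : ∀ c : ℂ, PowerSeries.coeff 1 (1 + PowerSeries.C c * PowerSeries.X) = c := fun c => by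
    rw [map_add, PowerSeries.coeff_C_mul]
    simp [PowerSeries.coeff_one]
  -- The constant terms of the `f₁`-coordinates identify `h₁(0)` with `u(0) ≠ 0`; with `v(0) = 0`,
  -- the coefficients of `b` then give `γ = γ'`.
  have h0 := congrArg (PowerSeries.coeff 0) c₁
  have h1 := congrArg (PowerSeries.coeff 1) c₁
  rw [mul_comm _ (PowerSeries.C (PowerSeries.coeff 0 h₁)), map_add, coeff_delta_zero,
    PowerSeries.coeff_C_mul, PowerSeries.coeff_C_mul, a0, a0, mul_one, mul_one, add_zero] at h0
  rw [mul_comm _ (PowerSeries.C (PowerSeries.coeff 0 h₁)), map_add, coeff_delta_succ,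
    PowerSeries.coeff_C_mul, PowerSeries.coeff_C_mul, a1, a1, map_add (PowerSeries.coeff 0),
    coeff_delta_zero, show PowerSeries.coeff 0 (v * (1 + PowerSeries.C γ' * PowerSeries.X)) = 0 by
      simpa using hv, add_zero, mul_zero, add_zero, h0] at h1
  exact (mul_left_cancel₀ (h0 ▸ hu) h1).symm

/-! ### Frescos with given fundamental invariants -/

theorem mk_bSeries_eq_zero {μ : ℂ} {S : PowerSeries ℂ}
    (h : (Submodule.Quotient.mk (bSeries S) : ERankOne μ) = 0) : S = 0 := by
  rw [Submodule.Quotient.mk_eq_zero] at h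
  obtain ⟨q, hq⟩ := Submodule.mem_span_singleton.1 h
  refine (eq_zero_of_mul_lin_add_eq_zero (q := -q) (μ := μ) ?_).2
  rw [← hq, smul_eq_mul, neg_mul, neg_add_cancel]

/-- The generator of a monogenic module with a quotient `E_μ` can be normalized, and then the kernel
is generated by its image under `a - μ b`. -/
theorem exists_generator {E : Type*} [AddCommGroup E] [Module AHat E] {F G : Submodule AHat E}
    {μ : ℂ} (hGF : G ≤ F) (θ : (F ⧸ G.submoduleOf F) ≃ₗ[AHat] ERankOne μ) {x : E}
    (hx : F = Submodule.span AHat {x}) :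
    ∃ (u : PowerSeries ℂ) (e : E), PowerSeries.coeff 0 u ≠ 0 ∧ x = bSeries u • e ∧
      F = Submodule.span AHat {e} ∧ G = Submodule.span AHat {lin μ • e} ∧
      ∀ S, bSeries S • e ∈ G → S = 0 := by
  have hxF : x ∈ F := hx ▸ Submodule.mem_span_singleton_self x
  obtain ⟨z, hz⟩ := Submodule.Quotient.mk_surjective _ (θ (Submodule.Quotient.mk ⟨x, hxF⟩))
  obtain ⟨q, u, rfl⟩ := exists_eq_mul_lin_add z μ
  have hz' : θ (Submodule.Quotient.mk ⟨x, hxF⟩) = Submodule.Quotient.mk (bSeries u) := by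
    rw [← hz, Submodule.Quotient.eq]
    exact Submodule.mem_span_singleton.2 ⟨q, by rw [smul_eq_mul]; abel⟩
  -- The class of `u(b)` generates `E_μ`, so some `c u(b) - 1` is a left multiple of `lin μ`; its
  -- degree-zero symbol vanishes, which forces `u(0) ≠ 0`.
  have hu : PowerSeries.coeff 0 u ≠ 0 := by
    obtain ⟨⟨y, hy⟩, hy'⟩ := Submodule.Quotient.mk_surjective _
      (θ.symm (Submodule.Quotient.mk 1))
    have hyx := hy
    rw [hx] at hyx
    obtain ⟨c, rfl⟩ := Submodule.mem_span_singleton.1 hyx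
    have h1 : (Submodule.Quotient.mk 1 : ERankOne μ) = Submodule.Quotient.mk (c * bSeries u) := by
      rw [← smul_eq_mul c, Submodule.Quotient.mk_smul, ← hz', ← map_smul, ← θ.symm_apply_eq, ← hy']
      rfl
    rw [Submodule.Quotient.eq] at h1
    obtain ⟨q', hq'⟩ := Submodule.mem_span_singleton.1 h1
    intro hu0
    have := congrArg (fun z => symb z 0 0) hq'
    simp [symb_lin, symb_sub, symb_zero_mul, symb_bSeries, symb_one, hu0] at this
  have hxe : x = bSeries u • bSeries u⁻¹ • x := by
    rw [smul_smul, bSeries_mul_inv hu, one_smul]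
  have heF : bSeries u⁻¹ • x ∈ F := F.smul_mem _ hxF
  have hθ : ∀ y : AHat, θ (Submodule.Quotient.mk ⟨y • bSeries u⁻¹ • x, F.smul_mem _ heF⟩) =
      Submodule.Quotient.mk y := by
    intro y
    have : (Submodule.Quotient.mk ⟨y • bSeries u⁻¹ • x, F.smul_mem _ heF⟩ : F ⧸ G.submoduleOf F) =
        (y * bSeries u⁻¹) • Submodule.Quotient.mk ⟨x, hxF⟩ := by
      rw [← Submodule.Quotient.mk_smul]
      congr 1
      exact Subtype.ext (smul_smul _ _ _)
    rw [this, map_smul, hz', ← Submodule.Quotient.mk_smul, smul_eq_mul, mul_assoc,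
      bSeries_inv_mul hu, mul_one]
  have hG : ∀ y : AHat, y • bSeries u⁻¹ • x ∈ G ↔ (Submodule.Quotient.mk y : ERankOne μ) = 0 := by
    intro y
    rw [← hθ, LinearEquiv.map_eq_zero_iff, Submodule.Quotient.mk_eq_zero]
    rfl
  refine ⟨u, bSeries u⁻¹ • x, hu, hxe, ?_, ?_, fun S hS => mk_bSeries_eq_zero ((hG _).1 hS)⟩
  · refine le_antisymm ?_ ((Submodule.span_singleton_le_iff_mem _ _).2 heF)
    rw [hx, Submodule.span_singleton_le_iff_mem]
    exact Submodule.mem_span_singleton.2 ⟨_, hxe.symm⟩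
  · refine le_antisymm (fun y hy => ?_) ((Submodule.span_singleton_le_iff_mem _ _).2 ((hG _).2 ?_))
    · have hyF := hGF hy
      rw [hx] at hyF
      obtain ⟨c, rfl⟩ := Submodule.mem_span_singleton.1 hyF
      rw [hxe, smul_smul, hG, Submodule.Quotient.mk_eq_zero] at hy
      obtain ⟨q', hq'⟩ := Submodule.mem_span_singleton.1 hy
      refine Submodule.mem_span_singleton.2 ⟨q', ?_⟩
      rw [smul_smul, ← smul_eq_mul, hq', ← smul_smul, ← hxe]
    · exact (Submodule.Quotient.mk_eq_zero _).2 (Submodule.mem_span_singleton_self _)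

/-- The filtration is descended from the top: the kernel of the normalized `F_j → E_μ` is again
monogenic, generated by `(a - μ b) e_j`, and normalizing that generator produces the next basis
vector and the units `T`, then `S`. -/
theorem HasFundamentalInvariants.exists_isTower {E : Type*} [AddCommGroup E] [Module AHat E]
    {l : Fin 3 → ℚ} (h : HasFundamentalInvariants E l) {e : E} (he : Submodule.span AHat {e} = ⊤) :
    ∃ S T e₁ e₂ e₃, IsTower (E := E) (l 0 : ℂ) (l 1 : ℂ) (l 2 : ℂ) S T e₁ e₂ e₃ := by
  obtain ⟨F, h0, hl, -, hF, -⟩ := h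
  obtain ⟨le₃, ⟨θ₃⟩⟩ := hF 2
  obtain ⟨le₂, ⟨θ₂⟩⟩ := hF 1
  obtain ⟨le₁, ⟨θ₁⟩⟩ := hF 0
  obtain ⟨-, e₃, -, -, hs₃, hk₃, hi₃⟩ := exists_generator le₃ θ₃ (hl.trans he.symm)
  obtain ⟨T, e₂, hT, hT', hs₂, hk₂, hi₂⟩ := exists_generator le₂ θ₂ hk₃
  obtain ⟨S, e₁, hS, hS', hs₁, hk₁, hi₁⟩ := exists_generator le₁ θ₁ hk₂
  have z₁ : lin (l 0 : ℂ) • e₁ = 0 := by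
    have : lin (l 0 : ℂ) • e₁ ∈ F (Fin.castSucc 0) := hk₁ ▸ Submodule.mem_span_singleton_self _
    rw [Fin.castSucc_zero, h0] at this
    exact (Submodule.mem_bot _).1 this
  have m₂ : e₂ ∈ F (Fin.castSucc 2) := hs₂ ▸ Submodule.mem_span_singleton_self e₂
  have m₁ : e₁ ∈ F (Fin.castSucc 1) := hs₁ ▸ Submodule.mem_span_singleton_self e₁
  have m₁' : e₁ ∈ F (Fin.castSucc 2) := le₂ m₁
  refine ⟨S, T, e₁, e₂, e₃, hT', hS', z₁, fun x => ?_, fun u v w hx => ?_, hS, hT⟩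
  · have hx : x ∈ F (Fin.succ 2) := by
      rw [show F (Fin.succ 2) = ⊤ from hl]
      trivial
    rw [hs₃] at hx
    obtain ⟨y, rfl⟩ := Submodule.mem_span_singleton.1 hx
    obtain ⟨q, u, rfl⟩ := exists_eq_mul_lin_add y (l 2 : ℂ)
    obtain ⟨q', v, hq'⟩ := exists_eq_mul_lin_add (q * bSeries T) (l 1 : ℂ)
    obtain ⟨q'', w, hq''⟩ := exists_eq_mul_lin_add (q' * bSeries S) (l 0 : ℂ)
    refine ⟨u, v, w, ?_⟩
    rw [add_smul, mul_smul, hT', smul_smul, hq', add_smul, mul_smul, hS', smul_smul, hq'', add_smul,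
      mul_smul, z₁, smul_zero, zero_add]
    abel
  · have hu : u = 0 := hi₃ u (by
      rw [add_assoc] at hx
      rw [eq_neg_of_add_eq_zero_left hx]
      exact Submodule.neg_mem _ (Submodule.add_mem _ (Submodule.smul_mem _ _ m₂)
        (Submodule.smul_mem _ _ m₁')))
    subst hu
    rw [map_zero, zero_smul, zero_add] at hx
    have hv : v = 0 := hi₂ v (by
      rw [eq_neg_of_add_eq_zero_left hx]
      exact Submodule.neg_mem _ (Submodule.smul_mem _ _ m₁))
    subst hv
    rw [map_zero, zero_smul, zero_add] at hx
    exact ⟨rfl, rfl, hi₁ w (by rw [hx]; exact Submodule.zero_mem _)⟩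

/-! ### Eigenvectors and the Bernstein polynomial -/

theorem IsFreeFinite.bSeries_smul_eq_zero {M : Type*} [AddCommGroup M] [Module AHat M]
    (h : IsFreeFinite M) {S : PowerSeries ℂ} (hS : S ≠ 0) {x : M} (hx : bSeries S • x = 0) :
    x = 0 := by
  let _ := bModule M
  have : Module.Free (PowerSeries ℂ) M := h.1
  have hx' : S • x = 0 := hx
  exact (smul_eq_zero.1 hx').resolve_left hS

theorem IsFreeFinite.exists_eq_b_pow_smul {M : Type*} [AddCommGroup M] [Module AHat M]
    (h : IsFreeFinite M) {x : M} (hx : x ≠ 0) :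
    ∃ (m : ℕ) (s : M), x = bSeries (PowerSeries.X ^ m) • s ∧ ∀ t, s ≠ b • t := by
  let _ := bModule M
  have : Module.Free (PowerSeries ℂ) M := h.1
  let B := Module.Free.chooseBasis (PowerSeries ℂ) M
  obtain ⟨i, hi⟩ : ∃ i, B.repr x i ≠ 0 := by
    by_contra! hc
    exact hx (B.repr.map_eq_zero_iff.1 (Finsupp.ext hc))
  -- A coordinate divisible by every power of `b` would be zero.
  have hn : ∃ n, ¬ ∃ s : M, x = bSeries (PowerSeries.X ^ n) • s := by
    by_contra! hc
    apply hi
    ext n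
    obtain ⟨s, hs⟩ := hc (n + 1)
    have hs' : x = (PowerSeries.X ^ (n + 1) : PowerSeries ℂ) • s := hs
    rw [hs', map_smul, Finsupp.smul_apply, smul_eq_mul, PowerSeries.coeff_X_pow_mul',
      if_neg (by omega), map_zero]
  classical
  have h0 : Nat.find hn ≠ 0 := fun h0 => by
    have := Nat.find_spec hn
    rw [h0] at this
    exact this ⟨x, by simp⟩
  obtain ⟨m, hm⟩ := Nat.exists_eq_succ_of_ne_zero h0
  obtain ⟨s, hs⟩ := not_not.1 (Nat.find_min hn (hm ▸ Nat.lt_succ_self m))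
  refine ⟨m, s, hs, fun t ht => Nat.find_spec hn ⟨t, ?_⟩⟩
  rw [hm, hs, ht, smul_smul, b, ← map_mul, ← pow_succ]

/-- In `E^♯` one writes `x = b^m s` with `s` outside `b E^♯`. Then `a s = (μ - m) b s`, so the class
of `s` is an eigenvector of `-b⁻¹ a` with eigenvalue `-(μ - m)`, a root of the Bernstein polynomial.
-/
theorem IsPrimitive.exists_int {E : Type*} [AddCommGroup E] [Module AHat E] {lam : ℚ}
    (h : IsPrimitive lam E) {μ : ℂ} {x : E} (hx : x ≠ 0) (hμ : lin μ • x = 0) :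
    ∃ m : ℤ, μ = lam + m := by
  obtain ⟨B, ⟨M, _, _, i, ⟨⟨hM, -⟩, hi, -⟩, T, hT, rfl⟩, hB⟩ := h
  let _ := cModule M
  obtain ⟨m, s, hs, hsb⟩ := hM.exists_eq_b_pow_smul (x := i x) (by
    rwa [Ne, map_eq_zero_iff i hi])
  have h1 : lin (μ - m) • s = 0 := by
    refine hM.bSeries_smul_eq_zero (pow_ne_zero m PowerSeries.X_ne_zero) ?_
    have h2 := lin_smul_bSeries_smul μ (μ - m) (PowerSeries.X ^ m) s
    rwa [← hs, ← map_smul, hμ, map_zero, delta_X_pow, show (m : ℂ) + (μ - m - μ) = 0 by ring,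
      map_zero, zero_mul, map_zero, zero_smul, add_zero, eq_comm] at h2
  have h2 : a • s = b • ((μ - m) • s) := by
    change a • s = b • bSeries (PowerSeries.C (μ - m)) • s
    rw [lin_eq, sub_smul, sub_eq_zero] at h1
    rw [h1, smul_smul, b, ← map_mul, mul_comm]
  have h3 := hT _ _ h2
  have h4 : (bSub M).mkQ s ≠ 0 := by
    rw [Submodule.mkQ_apply, Ne, Submodule.Quotient.mk_eq_zero]
    rintro ⟨t, ht⟩
    exact hsb t ht
  rw [map_smul, ← neg_smul] at h3
  have h5 : T.HasEigenvalue (-(μ - m)) :=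
    Module.End.hasEigenvalue_of_hasEigenvector (Module.End.hasEigenvector_iff.2
      ⟨Module.End.mem_eigenspace_iff.2 h3, h4⟩)
  obtain ⟨m', hm'⟩ := hB _ (Module.End.isRoot_of_hasEigenvalue h5)
  refine ⟨m' + m, ?_⟩
  push_cast
  linear_combination hm'

/-! ### Maps to modules of asymptotic expansions -/

/-- The element `f₀ e₀ + f₁ e₁ + f₂ e₂`. -/
def Xi.vec (lam : ℂ) (f₀ f₁ f₂ : PowerSeries ℂ) : Xi lam 2 := (![f₀, f₁, f₂] : Fin 3 → _)

namespace Xi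

variable {lam μ : ℂ}

theorem vec_inj {f₀ f₁ f₂ g₀ g₁ g₂ : PowerSeries ℂ} (h : vec lam f₀ f₁ f₂ = vec lam g₀ g₁ g₂) :
    f₀ = g₀ ∧ f₁ = g₁ ∧ f₂ = g₂ :=
  ⟨congrFun h 0, congrFun h 1, congrFun h 2⟩

theorem bSeries_smul_vec (S f₀ f₁ f₂ : PowerSeries ℂ) :
    bSeries S • vec lam f₀ f₁ f₂ = vec lam (S * f₀) (S * f₁) (S * f₂) := by
  funext j
  rw [bSeries_smul]
  fin_cases j <;> rfl

theorem vec_zero : vec lam 0 0 0 = 0 := by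
  funext j
  fin_cases j <;> rfl

theorem lin_smul_vec (f₀ f₁ f₂ : PowerSeries ℂ) : lin μ • vec lam f₀ f₁ f₂ =
    vec lam (delta (lam - μ) f₀ + PowerSeries.X * f₁) (delta (lam - μ) f₁ + PowerSeries.X * f₂)
      (delta (lam - μ) f₂) := by
  have h : ∀ (f : Xi lam 2) j, (lin μ • f) j = opA f j - PowerSeries.C μ * PowerSeries.X * f j := by
    intro f j
    rw [lin_eq, sub_smul, a_smul, ← bSeries_smul]
    rfl
  funext j
  rw [h, opA]
  fin_cases j <;> simp [delta, vec] <;> ring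

theorem delta_C_mul_X_pow {n : ℕ} (hn : μ = lam + n) (t : ℂ) :
    delta (lam - μ) (PowerSeries.C t * PowerSeries.X ^ n) = 0 := by
  rw [delta_C_mul, delta_X_pow, hn, show (n : ℂ) + (lam - (lam + n)) = 0 by ring]
  simp

/-- Solutions of `(a - μ b) f = g e₀`. -/
theorem exists_lin_smul_vec_eq {n : ℕ} (hn : μ = lam + n) {g : PowerSeries ℂ}
    (h : PowerSeries.coeff 0 g = 0) :
    ∃ f, lin μ • vec lam f (PowerSeries.C (PowerSeries.coeff (n + 1) g) * PowerSeries.X ^ n) 0 =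
      vec lam g 0 0 := by
  obtain ⟨f, hf⟩ := exists_delta_eq (lam - μ)
    (g - PowerSeries.X * (PowerSeries.C (PowerSeries.coeff (n + 1) g) * PowerSeries.X ^ n))
    (by simpa using h) (fun k hk => by
      have hk' : k = n := by
        rw [hn] at hk
        have : (k : ℂ) = n := by linear_combination hk
        exact_mod_cast this
      rw [hk', map_sub, PowerSeries.coeff_succ_X_mul, PowerSeries.coeff_C_mul,
        PowerSeries.coeff_X_pow_self, mul_one, sub_self])
  refine ⟨f, ?_⟩
  rw [lin_smul_vec, hf, delta_C_mul_X_pow hn]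
  simp

/-- Solutions of `(a - μ b) f = g₀ e₀ + g₁ e₁`. -/
theorem exists_lin_smul_eq_vec {n : ℕ} (hn : μ = lam + n) {g₀ g₁ : PowerSeries ℂ}
    (h₀ : PowerSeries.coeff 0 g₀ = 0) (h₁ : PowerSeries.coeff 0 g₁ = 0) :
    ∃ f, lin μ • f = vec lam g₀ g₁ 0 := by
  obtain ⟨f₁, hf₁⟩ := exists_lin_smul_vec_eq hn h₁
  rw [lin_smul_vec] at hf₁
  obtain ⟨hf₁, -, -⟩ := vec_inj hf₁
  -- The `e₁`-coordinate is determined only up to multiples of `b^n`; this freedom absorbs the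
  -- resonant coefficient on `e₀`.
  set t := PowerSeries.coeff (n + 1) g₀ - PowerSeries.coeff n f₁ with ht
  obtain ⟨f₀, hf₀⟩ := exists_delta_eq (lam - μ)
    (g₀ - PowerSeries.X * (f₁ + PowerSeries.C t * PowerSeries.X ^ n))
    (by simpa using h₀) (fun k hk => by
      have hk' : k = n := by
        rw [hn] at hk
        have : (k : ℂ) = n := by linear_combination hk
        exact_mod_cast this
      rw [hk', map_sub, PowerSeries.coeff_succ_X_mul, map_add, PowerSeries.coeff_C_mul,
        PowerSeries.coeff_X_pow_self, ht]
      ring)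
  refine ⟨vec lam f₀ (f₁ + PowerSeries.C t * PowerSeries.X ^ n)
    (PowerSeries.C (PowerSeries.coeff (n + 1) g₁) * PowerSeries.X ^ n), ?_⟩
  have hadd : ∀ S R, delta (lam - μ) (S + R) = delta (lam - μ) S + delta (lam - μ) R := by
    intro S R
    simp only [delta, map_add]
    ring
  rw [lin_smul_vec, hf₀, hadd, delta_C_mul_X_pow hn, delta_C_mul_X_pow hn, add_zero, hf₁,
    sub_add_cancel]

end Xi

/-- `Module.finrank` bounds the size of independent families only for finite modules, so finiteness
has to precede any use of a rank bound. -/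
theorem IsTower.finite_range {E M : Type*} [AddCommGroup E] [Module AHat E] [AddCommGroup M]
    [Module AHat M] {μ₁ μ₂ μ₃ : ℂ} {S T : PowerSeries ℂ} {e₁ e₂ e₃ : E}
    (h : IsTower μ₁ μ₂ μ₃ S T e₁ e₂ e₃) (φ : E →ₗ[AHat] M) :
    letI := bModule (LinearMap.range φ)
    Module.Finite (PowerSeries ℂ) (LinearMap.range φ) := by
  let _ := bModule (LinearMap.range φ)
  let y : Fin 3 → LinearMap.range φ := ![φ.rangeRestrict e₃, φ.rangeRestrict e₂, φ.rangeRestrict e₁]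
  refine Module.Finite.of_surjective (Fintype.linearCombination (PowerSeries ℂ) y) ?_
  rintro ⟨_, x, rfl⟩
  obtain ⟨u, v, w, rfl⟩ := h.span x
  refine ⟨![u, v, w], ?_⟩
  rw [Fintype.linearCombination_apply, Fin.sum_univ_three]
  change bSeries u • φ.rangeRestrict e₃ + bSeries v • φ.rangeRestrict e₂ +
    bSeries w • φ.rangeRestrict e₁ = φ.rangeRestrict _
  simp only [map_add, map_smul]

/-- If `φ : E → Ξ` has rank at most one and `φ x ≠ 0`, then every coordinate that vanishes on `φ x`
vanishes on the image of `φ`. -/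
theorem IsTower.apply_eq_zero {E : Type*} [AddCommGroup E] [Module AHat E] {lam : ℂ} {N : ℕ}
    {μ₁ μ₂ μ₃ : ℂ} {S T : PowerSeries ℂ} {e₁ e₂ e₃ : E} (h : IsTower μ₁ μ₂ μ₃ S T e₁ e₂ e₃)
    (φ : E →ₗ[AHat] Xi lam N) (hφ : abRank (LinearMap.range φ) ≤ 1) {x y : E} {i j : Fin (N + 1)}
    (hi : φ x i ≠ 0) (hj : φ x j = 0) : φ y j = 0 := by
  by_contra hy
  let _ := bModule (LinearMap.range φ)
  have := h.finite_range φ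
  have hli : LinearIndependent (PowerSeries ℂ) ![φ.rangeRestrict x, φ.rangeRestrict y] := by
    rw [LinearIndependent.pair_iff]
    intro s t hst
    have h1 : bSeries s • φ x + bSeries t • φ y = 0 := congrArg Subtype.val hst
    have h2 : ∀ k, s * φ x k + t * φ y k = 0 := fun k => by
      rw [← Xi.bSeries_smul, ← Xi.bSeries_smul]
      exact congrFun h1 k
    have ht : t = 0 := by
      have := h2 j
      rw [hj, mul_zero, zero_add] at this
      exact (mul_eq_zero.1 this).resolve_right hy
    have := h2 i
    rw [ht, zero_mul, add_zero] at this
    exact ⟨(mul_eq_zero.1 this).resolve_right hi, ht⟩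
  have := hli.fintype_card_le_finrank
  rw [Fintype.card_fin] at this
  exact absurd (this.trans hφ) (by norm_num)

/-! ### Semi-simple modules of rank three -/

namespace IsTower

variable {E : Type*} [AddCommGroup E] [Module AHat E] {lam μ₁ μ₂ μ₃ : ℂ}
  {S T : PowerSeries ℂ} {e₁ e₂ e₃ : E}

theorem coeff_T_eq_zero (h : IsTower μ₁ μ₂ μ₃ S T e₁ e₂ e₃)
    (hE : ∀ φ : E →ₗ[AHat] Xi lam 2, abRank (LinearMap.range φ) ≤ 1) {m n p₂ : ℕ}
    (hm : μ₂ = lam + m) (hn : μ₃ = lam + n) (hm0 : m ≠ 0) (hp₂ : n + 1 = m + p₂) :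
    PowerSeries.coeff p₂ T = 0 := by
  -- The map sends `e₁` to `0` and `e₂` to `b^m` times the first basis vector of `Ξ`. The image of
  -- `e₃` then has second coordinate `t b^n`, where `t` is the coefficient of `b^{n+1}` in `T b^m`,
  -- that is, of `b^{p₂}` in `T`.
  obtain ⟨f, hf⟩ := Xi.exists_lin_smul_vec_eq hn (g := T * PowerSeries.X ^ m) (by
    rw [PowerSeries.coeff_mul_X_pow', if_neg (by omega)])
  obtain ⟨φ, -, h₂, h₃⟩ := h.exists_hom (f₁ := 0) (f₂ := Xi.vec lam (PowerSeries.X ^ m) 0 0)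
    (hf.trans (by simp [Xi.bSeries_smul_vec])) (by
      have := Xi.delta_C_mul_X_pow hm 1
      rw [map_one, one_mul] at this
      simp [Xi.lin_smul_vec, this, Xi.vec_zero]) (smul_zero _)
  have := h.apply_eq_zero φ (hE φ) (x := e₂) (y := e₃) (i := 0) (j := 1)
    (by rw [h₂]; exact pow_ne_zero m PowerSeries.X_ne_zero) (by rw [h₂]; rfl)
  rw [h₃] at this
  have h1 := (mul_eq_zero.1 this).resolve_right (pow_ne_zero n PowerSeries.X_ne_zero)
  rw [hp₂, add_comm, PowerSeries.coeff_mul_X_pow] at h1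
  simpa using congrArg (PowerSeries.coeff 0) h1

theorem coeff_S_eq_zero (h : IsTower μ₁ μ₂ μ₃ S 1 e₁ e₂ e₃)
    (hE : ∀ φ : E →ₗ[AHat] Xi lam 2, abRank (LinearMap.range φ) ≤ 1) {k m n p₁ p₂ : ℕ}
    (hk : μ₁ = lam + k) (hm : μ₂ = lam + m) (hn : μ₃ = lam + n) (hk2 : 2 ≤ k)
    (hm0 : m ≠ 0) (hp₁ : m + 1 = k + p₁) (hp₂ : n + 1 = m + p₂) :
    PowerSeries.coeff p₁ S = 0 ∧ PowerSeries.coeff (p₁ + p₂) S = 0 := by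
  have r₁ : lin μ₁ • Xi.vec lam (PowerSeries.X ^ k) 0 0 = 0 := by
    have := Xi.delta_C_mul_X_pow hk 1
    rw [map_one, one_mul] at this
    simp [Xi.lin_smul_vec, this, Xi.vec_zero]
  obtain ⟨f, hf⟩ := Xi.exists_lin_smul_vec_eq hm (g := S * PowerSeries.X ^ k) (by
    rw [PowerSeries.coeff_mul_X_pow', if_neg (by omega)])
  have hc : PowerSeries.coeff (m + 1) (S * PowerSeries.X ^ k) = PowerSeries.coeff p₁ S := by
    rw [hp₁, add_comm, PowerSeries.coeff_mul_X_pow]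
  rw [hc] at hf
  have r₂ := hf.trans (show Xi.vec lam (S * PowerSeries.X ^ k) 0 0 =
    bSeries S • Xi.vec lam (PowerSeries.X ^ k) 0 0 by simp [Xi.bSeries_smul_vec])
  rw [Xi.lin_smul_vec] at hf
  obtain ⟨hf, -, -⟩ := Xi.vec_inj hf
  -- Solvability for the image of `e₃` needs this. As `k ≥ 2` and `m ≠ 0`, neither `S b^k` nor the
  -- logarithmic term has a coefficient at `b`, and `delta` multiplies `f(0)` by `-m ≠ 0`.
  have hf0 : PowerSeries.coeff 0 f = 0 := by
    have h1 := congrArg (PowerSeries.coeff 1) hf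
    rw [map_add, coeff_delta_succ, PowerSeries.coeff_mul_X_pow', if_neg (by omega), mul_left_comm,
      ← pow_succ', PowerSeries.coeff_C_mul, PowerSeries.coeff_X_pow, if_neg (by omega), mul_zero,
      add_zero] at h1
    refine (mul_eq_zero.1 h1).resolve_left ?_
    rw [hm]
    simpa using hm0
  -- The image of `e₂` may still have a logarithmic term, so the image of `e₃` may need all three
  -- basis vectors of `Ξ`.
  have hS : PowerSeries.coeff p₁ S = 0 := by
    obtain ⟨f₃, hf₃⟩ := Xi.exists_lin_smul_eq_vec hn hf0
      (g₁ := PowerSeries.C (PowerSeries.coeff p₁ S) * PowerSeries.X ^ m) (by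
        rw [PowerSeries.coeff_mul_X_pow', if_neg (by omega)])
    obtain ⟨φ, h₁, h₂, -⟩ := h.exists_hom (hf₃.trans (by rw [map_one, _root_.one_smul])) r₂ r₁
    have := h.apply_eq_zero φ (hE φ) (x := e₁) (y := e₂) (i := 0) (j := 1)
      (by rw [h₁]; exact pow_ne_zero k PowerSeries.X_ne_zero) (by rw [h₁]; rfl)
    rw [h₂] at this
    have h1 := (mul_eq_zero.1 this).resolve_right (pow_ne_zero m PowerSeries.X_ne_zero)
    simpa using congrArg (PowerSeries.coeff 0) h1
  refine ⟨hS, ?_⟩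
  rw [hS, map_zero, zero_mul] at hf r₂
  obtain ⟨f₃, hf₃⟩ := Xi.exists_lin_smul_vec_eq hn hf0
  obtain ⟨φ, h₁, -, h₃⟩ := h.exists_hom (hf₃.trans (by rw [map_one, _root_.one_smul])) r₂ r₁
  have := h.apply_eq_zero φ (hE φ) (x := e₁) (y := e₃) (i := 0) (j := 1)
    (by rw [h₁]; exact pow_ne_zero k PowerSeries.X_ne_zero) (by rw [h₁]; rfl)
  rw [h₃] at this
  have h1 := (mul_eq_zero.1 this).resolve_right (pow_ne_zero n PowerSeries.X_ne_zero)
  have h2 : PowerSeries.coeff (n + 1) f = 0 := by simpa using congrArg (PowerSeries.coeff 0) h1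
  -- The equation for `f` relates its coefficient at `b^{n+1}`, now known to vanish, to that of `S`
  -- at `b^{n+2-k}`, and `n + 2 - k = p₁ + p₂`.
  have h3 := congrArg (PowerSeries.coeff (n + 1 + 1)) hf
  rwa [mul_zero, add_zero, coeff_delta_succ, h2, mul_zero,
    show n + 1 + 1 = p₁ + p₂ + k by omega, PowerSeries.coeff_mul_X_pow, eq_comm] at h3

theorem exists_change_T_eq_one (h : IsTower μ₁ μ₂ μ₃ S T e₁ e₂ e₃) {p₂ : ℕ}
    (hμ : μ₃ = μ₂ + p₂ - 1) (hT : PowerSeries.coeff p₂ T = 0) :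
    ∃ S' e₂' e₃', IsTower μ₁ μ₂ μ₃ S' 1 e₁ e₂' e₃' := by
  obtain ⟨v, hv⟩ := exists_delta_eq (μ₂ - μ₃) (PowerSeries.C (PowerSeries.coeff 0 T) - T)
    (by simp) (fun n hn => by
      have hn' : n + 1 = p₂ := by
        have : ((n + 1 : ℕ) : ℂ) = p₂ := by
          push_cast
          linear_combination hn + hμ
        exact_mod_cast this
      rw [map_sub, PowerSeries.coeff_C, if_neg (by omega), hn', hT, sub_zero])
  refine ⟨_, _, _, h.change h.coeff_T (v := v) (w := 0) (by rw [hv]; ring) rfl rfl ?_⟩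
  rw [map_add, coeff_delta_zero, PowerSeries.coeff_C_mul, add_zero]
  exact mul_ne_zero h.coeff_T h.coeff_S

theorem exists_change_S_eq (h : IsTower μ₁ μ₂ μ₃ S 1 e₁ e₂ e₃) {p₁ p₂ : ℕ}
    (hμ₂ : μ₂ = μ₁ + p₁ - 1) (hμ₃ : μ₃ = μ₂ + p₂ - 1) (hp₁ : 2 ≤ p₁) (hp₂ : 1 ≤ p₂)
    (hS₁ : PowerSeries.coeff p₁ S = 0) (hS₂ : PowerSeries.coeff (p₁ + p₂) S = 0) :
    ∃ γ e₁' e₂' e₃', IsTower (E := E) μ₁ μ₂ μ₃ (1 + PowerSeries.C γ * PowerSeries.X) 1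
      e₁' e₂' e₃' := by
  set s₀ := PowerSeries.coeff 0 S with hs₀
  set s₁ := PowerSeries.coeff 1 S with hs₁
  set R := PowerSeries.C s₀ + PowerSeries.C s₁ * PowerSeries.X - S with hR
  have R0 : PowerSeries.coeff 0 R = 0 := by simp [hR, hs₀]
  have R1 : PowerSeries.coeff 1 R = 0 := by
    rw [hR, map_sub, map_add, PowerSeries.coeff_C_mul, PowerSeries.coeff_C]
    simp [hs₁]
  have R2 : ∀ n, PowerSeries.coeff (n + 2) R = -PowerSeries.coeff (n + 2) S := by
    intro n
    rw [hR, map_sub, map_add, PowerSeries.coeff_C_mul, PowerSeries.coeff_C, PowerSeries.coeff_X]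
    simp
  obtain ⟨r, hr⟩ := exists_delta_eq (μ₁ - μ₂) R R0 (fun n hn => by
    have hn' : n + 1 = p₁ := by
      have : ((n + 1 : ℕ) : ℂ) = p₁ := by
        push_cast
        linear_combination hn + hμ₂
      exact_mod_cast this
    obtain ⟨j, rfl⟩ := Nat.exists_eq_add_of_le' hp₁
    rw [hn', R2, hS₁, neg_zero])
  have hcoef : ∀ n : ℕ, ((n : ℂ) + (μ₁ - μ₂)) * PowerSeries.coeff n r = PowerSeries.coeff (n + 1) R :=
    fun n => by rw [← hr, coeff_delta_succ]
  -- With `v = 0`, the series `r` must have the form `delta (μ₁ - μ₃) w`, hence no constant term.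
  -- This is why the coefficient `s₁` of `S` is kept in `R`.
  have r0 : PowerSeries.coeff 0 r = 0 := by
    have := hcoef 0
    rw [zero_add, R1] at this
    refine (mul_eq_zero.1 this).resolve_left fun h0 => ?_
    have : (p₁ : ℂ) = 1 := by
      push_cast at h0
      linear_combination hμ₂ - h0 - 2 * hμ₂
    exact absurd (by exact_mod_cast this : p₁ = 1) (by omega)
  -- The resonance is at `n = p₁ + p₂ - 2`. There `p₂` times the coefficient of `b^{n+1}` in `r` is
  -- that of `b^{p₁+p₂}` in `R`, which vanishes by `hS₂`.
  obtain ⟨w, hw⟩ := exists_delta_eq (μ₁ - μ₃) r r0 (fun n hn => by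
    have hn' : n + 2 = p₁ + p₂ := by
      have : ((n + 2 : ℕ) : ℂ) = ((p₁ + p₂ : ℕ) : ℂ) := by
        push_cast
        linear_combination hn + hμ₂ + hμ₃
      exact_mod_cast this
    have := hcoef (n + 1)
    rw [R2, hn', hS₂, neg_zero] at this
    refine (mul_eq_zero.1 this).resolve_left fun h0 => ?_
    have : (p₂ : ℂ) = 0 := by
      push_cast at h0
      linear_combination h0 - hn - hμ₃
    exact absurd (by exact_mod_cast this : p₂ = 0) (by omega))
  have hS' : PowerSeries.C s₀ + PowerSeries.C s₁ * PowerSeries.X =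
      PowerSeries.C 1 * S + delta (μ₁ - μ₂) r := by
    rw [hr, hR, map_one]
    ring
  have h' := (h.change one_ne_zero (v := 0) (w := w) (by simp) (by rw [hw]; ring) hS'
    (by simpa [hs₀] using h.coeff_S)).rescale h.coeff_S
  rw [mul_add, ← mul_assoc, ← map_mul, ← map_mul, ← hs₀, inv_mul_cancel₀ h.coeff_S,
    map_one (PowerSeries.C (R := ℂ))] at h'
  exact ⟨s₀⁻¹ * s₁, _, _, _, h'⟩

end IsTower

theorem IsFresco.exists_equiv_EGamma {l₁ : ℚ} (hl₁ : 2 < l₁) {p₁ p₂ : ℕ} (hp₁ : 2 ≤ p₁)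
    (hp₂ : 1 ≤ p₂) {lam : ℚ} (hlam : lam ≤ 1) {E : Type*} [AddCommGroup E]
    [Module AHat E] (hE : IsFresco E) (hprim : IsPrimitive lam E) (hss : IsSemisimpleFresco lam E)
    (hinv : HasFundamentalInvariants E ![l₁, l₁ + p₁ - 1, l₁ + p₁ - 1 + p₂ - 1]) :
    ∃ γ : ℂ, Nonempty (E ≃ₗ[AHat] EGamma l₁ p₁ p₂ γ) := by
  obtain ⟨-, e, he⟩ := hE
  obtain ⟨S, T, e₁, e₂, e₃, h⟩ := hinv.exists_isTower he
  simp only [Matrix.cons_val] at h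
  push_cast at h
  have he₁ : e₁ ≠ 0 := fun h0 => by
    simpa using (h.indep 0 0 1 (by simp [h0])).2.2
  obtain ⟨z, hz⟩ := hprim.exists_int he₁ h.lin_one
  have hz' : l₁ = lam + z := by exact_mod_cast hz
  obtain ⟨k, rfl⟩ : ∃ k : ℕ, z = k := Int.eq_ofNat_of_zero_le (by
    have : (0 : ℚ) < z := by linarith
    exact_mod_cast this.le)
  -- From `λ₁ > 2` and `lam ≤ 1` the integer `k = λ₁ - lam` exceeds `1`.
  have hk2 : 2 ≤ k := by
    have : (1 : ℚ) < k := by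
      rw [Int.cast_natCast] at hz'
      linarith
    exact_mod_cast this
  rw [Int.cast_natCast] at hz
  have hm : (l₁ : ℂ) + p₁ - 1 = lam + (k + p₁ - 1 : ℕ) := by
    push_cast [show 1 ≤ k + p₁ by omega]
    linear_combination hz
  have hn : (l₁ : ℂ) + p₁ - 1 + p₂ - 1 = lam + (k + p₁ - 1 + p₂ - 1 : ℕ) := by
    push_cast [show 1 ≤ k + p₁ - 1 + p₂ by omega, show 1 ≤ k + p₁ by omega]
    linear_combination hz
  have hT := h.coeff_T_eq_zero (p₂ := p₂) (hss 2) hm hn (by omega) (by omega)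
  obtain ⟨S', e₂', e₃', h'⟩ := h.exists_change_T_eq_one rfl hT
  obtain ⟨hS₁, hS₂⟩ := h'.coeff_S_eq_zero (p₁ := p₁) (p₂ := p₂) (hss 2) hz hm hn hk2 (by omega)
    (by omega) (by omega)
  obtain ⟨γ, _, _, _, h''⟩ := h'.exists_change_S_eq rfl rfl hp₁ hp₂ hS₁ hS₂
  exact ⟨γ, h''.equiv_EGamma⟩

end Fresco
end

theorem mainTheorem10 (l₁ : ℚ) (hl₁ : 2 < l₁) (p₁ p₂ : ℕ) (hp₁ : 2 ≤ p₁) (hp₂ : 1 ≤ p₂) :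
    (∀ lam : ℚ, 0 < lam → lam ≤ 1 →
      ∀ (E : Type*) [AddCommGroup E] [Module Fresco.AHat E],
        Fresco.IsFresco E → Fresco.IsPrimitive lam E → Fresco.abRank E = 3 →
        Fresco.IsSemisimpleFresco lam E →
        Fresco.HasFundamentalInvariants E ![l₁, l₁ + p₁ - 1, l₁ + p₁ - 1 + p₂ - 1] →
        ∃ γ : ℂ, Nonempty (E ≃ₗ[Fresco.AHat] Fresco.EGamma l₁ p₁ p₂ γ)) ∧
    (2 ≤ p₂ → ∀ γ γ' : ℂ, γ ≠ γ' →
      IsEmpty (Fresco.EGamma l₁ p₁ p₂ γ ≃ₗ[Fresco.AHat] Fresco.EGamma l₁ p₁ p₂ γ')) ∧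
    (p₂ = 1 → ∀ γ : ℂ,
      Nonempty (Fresco.EGamma l₁ p₁ p₂ γ ≃ₗ[Fresco.AHat] Fresco.EGamma l₁ p₁ p₂ 0)) := by
  refine ⟨fun lam _ hlam E _ _ hE hprim _ hss hinv =>
    hE.exists_equiv_EGamma hl₁ hp₁ hp₂ hlam hprim hss hinv, fun hp γ γ' hγ =>
    Fresco.isEmpty_equiv_EGamma l₁ hp₁ hp hγ, ?_⟩
  rintro rfl γ
  exact Fresco.equiv_EGamma_zero l₁ hp₁ γ
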